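/- Let $H_{p-1}=\sum_{k=1}^{p-1}\frac1k$ and let $B_m$ denote the $m$-th Bernoulli number. For rational numbers $a,b$, a prime $p$ and $n\ge 1$, write $a\equiv b\pmod{p^n}$ if $a-b=p^n c$ for a rational number $c$ whose reduced denominator is not divisible by $p$. Then for every prime $p>5$, $$\sum_{k=0}^{(p-3)/2}\frac{\binom{2k}{k}}{16^k(2k+1)}\equiv(-1)^{(p-1)/2}\left(\frac{H_{p-1}}{12}+\frac{3}{160}\,p^4B_{p-5}\right)\pmod{p^5}$$ and $$\sum_{k=0}^{(p-3)/2}\frac{\binom{2k}{k}}{(-16)^k(2k+1)^2}\equiv\frac{H_{p-1}}{5p}+\frac{7}{200}\,p^3B_{p-5}\pmod{p^4}.$$ -/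

import Mathlib

/-- Congruence of rational numbers modulo `p ^ n`: the difference `a - b` is `p ^ n` times a
rational number whose reduced denominator is not divisible by `p`. -/
def RatModEqPrimePow (p n : ℕ) (a b : ℚ) : Prop :=
  ∃ c : ℚ, ¬ p ∣ c.den ∧ a - b = (p : ℚ) ^ n * c

/-! Write `p = 2n + 1` and compute in the localization of ℤ at `p`, inside ℚ. Both sums are finite
forms of accelerated series for `∑ (-1)^k/(2k+1)` and `∑ 1/(2k+1)²`. Telescoping gives exact
identities, `sum_choose_div_sixteen_pow` and `sum_choose_div_neg_sixteen_pow`: `3/4` (resp. `5/4`)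
of the binomial sum is a plain sum over the odd numbers below `p` plus a remainder. Read backwards,
the remainder is `oddProd p n` times a sum of products of `1 - p²/(p-2j)²`, which expand in powers
of `p`.

For the second congruence, the geometric expansion of `1/(p-2k)` leaves the sums `S_s = ∑_{k≤n}
k^{-s}` and double sums of weight 4 and 5. Splitting `1, …, p-1` into pairs `k, p-k` or into pairs
`2k, p-2k` evaluates one sum in two ways. This expresses `S_2, S_3, S_4` through `H_{p-1}/p` and
`S_5`, and the same device applied to `∑ k^{p-5} ≡ p B_{p-5} (mod p²)` gives `S_5 ≡ -6 B_{p-5}`.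
Faulhaber's formula settles the double sums of weight 5 (`invPowSum₂_add_mem`).

The first congruence also contains the alternating sum `A = ∑ (-1)^k/(p-2k)`, the harmonic number
`H_n`, and double sums of weight 3 and 4 with no such evaluation. Two formulas for `A` remove them:
the expansion `altSubTwo_one_add_mem`, and the exact product identity `sum_invSub_mul_reflProd`,
whose nested sums match those of the remainder. What survives is a triple sum of weight 5. It equals
`2 ∑ (-1)^k/k^5` modulo `p` by the closed form `starSum_eq`, and so is again a multiple of
`B_{p-5}`. -/

open Finset

/-! ### Congruences in the localization of ℤ at `p` -/

/-- The rational numbers whose denominator is prime to `p`. -/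
def pIntegral (p : ℕ) [hp : Fact p.Prime] : Subring ℚ where
  carrier := {x | ¬ p ∣ x.den}
  mul_mem' {a b} ha hb h := by
    rcases (hp.out.dvd_mul).1 (h.trans (Rat.mul_den_dvd a b)) with h | h
    exacts [ha h, hb h]
  add_mem' {a b} ha hb h := by
    rcases (hp.out.dvd_mul).1 (h.trans (Rat.add_den_dvd a b)) with h | h
    exacts [ha h, hb h]
  one_mem' := by simpa using hp.out.one_lt.ne'
  zero_mem' := by simpa using hp.out.one_lt.ne'
  neg_mem' {a} ha := by simpa using ha

/-- The rational numbers divisible by `p ^ k` in the localization of `ℤ` at `p`. -/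
def pIdeal (p : ℕ) [Fact p.Prime] (k : ℕ) : AddSubgroup ℚ where
  carrier := {x | ∃ c ∈ pIntegral p, x = (p : ℚ) ^ k * c}
  add_mem' := by
    rintro _ _ ⟨c, hc, rfl⟩ ⟨d, hd, rfl⟩
    exact ⟨c + d, add_mem hc hd, by ring⟩
  zero_mem' := ⟨0, zero_mem _, by simp⟩
  neg_mem' := by
    rintro _ ⟨c, hc, rfl⟩
    exact ⟨-c, neg_mem hc, by ring⟩

section

variable {p : ℕ} [hp : Fact p.Prime]

theorem ratModEqPrimePow_iff_mem_pIdeal {k : ℕ} {a b : ℚ} :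
    RatModEqPrimePow p k a b ↔ a - b ∈ pIdeal p k := Iff.rfl

theorem mem_pIdeal_of_eq {k : ℕ} {x c : ℚ} (hc : c ∈ pIntegral p) (h : x = (p : ℚ) ^ k * c) :
    x ∈ pIdeal p k := ⟨c, hc, h⟩

theorem mem_pIdeal_zero {x : ℚ} : x ∈ pIdeal p 0 ↔ x ∈ pIntegral p :=
  ⟨by rintro ⟨c, hc, rfl⟩; simpa using hc, fun h => ⟨x, h, by simp⟩⟩

theorem pIdeal_mono {j k : ℕ} (h : j ≤ k) {x : ℚ} (hx : x ∈ pIdeal p k) : x ∈ pIdeal p j := by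
  obtain ⟨c, hc, rfl⟩ := hx
  obtain ⟨d, rfl⟩ := Nat.exists_eq_add_of_le h
  exact ⟨(p : ℚ) ^ d * c, mul_mem (pow_mem (natCast_mem _ p) d) hc, by ring⟩

theorem mem_pIntegral_of_mem_pIdeal {k : ℕ} {x : ℚ} (hx : x ∈ pIdeal p k) : x ∈ pIntegral p :=
  mem_pIdeal_zero.1 (pIdeal_mono (Nat.zero_le k) hx)

theorem mul_mem_pIdeal_add {j k : ℕ} {x y : ℚ} (hx : x ∈ pIdeal p j) (hy : y ∈ pIdeal p k) :
    x * y ∈ pIdeal p (j + k) := by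
  obtain ⟨c, hc, rfl⟩ := hx
  obtain ⟨d, hd, rfl⟩ := hy
  exact ⟨c * d, mul_mem hc hd, by ring⟩

theorem mul_mem_pIdeal {k : ℕ} {c x : ℚ} (hc : c ∈ pIntegral p) (hx : x ∈ pIdeal p k) :
    c * x ∈ pIdeal p k := by
  simpa using mul_mem_pIdeal_add (mem_pIdeal_zero.2 hc) hx

theorem pow_mul_mem_pIdeal {k : ℕ} (j : ℕ) {x : ℚ} (hx : x ∈ pIdeal p k) :
    (p : ℚ) ^ j * x ∈ pIdeal p (j + k) := by
  obtain ⟨c, hc, rfl⟩ := hx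
  exact ⟨c, hc, by ring⟩

theorem pow_mul_mem_pIdeal_iff {j k : ℕ} {x : ℚ} :
    (p : ℚ) ^ j * x ∈ pIdeal p (j + k) ↔ x ∈ pIdeal p k := by
  refine ⟨?_, pow_mul_mem_pIdeal j⟩
  rintro ⟨c, hc, h⟩
  have hp0 : (p : ℚ) ≠ 0 := Nat.cast_ne_zero.2 hp.out.ne_zero
  refine ⟨c, hc, mul_left_cancel₀ (pow_ne_zero j hp0) ?_⟩
  rw [h]; ring

theorem inv_natCast_mem_pIntegral {m : ℕ} (hm : ¬ p ∣ m) : (m : ℚ)⁻¹ ∈ pIntegral p := by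
  have hm0 : 0 < m := Nat.pos_of_ne_zero (by rintro rfl; simp at hm)
  change ¬ p ∣ ((m : ℚ)⁻¹).den
  rwa [Rat.inv_natCast_den_of_pos hm0]

theorem mem_pIdeal_of_natCast_mul_mem {k m : ℕ} {x : ℚ} (hm : ¬ p ∣ m)
    (h : (m : ℚ) * x ∈ pIdeal p k) : x ∈ pIdeal p k := by
  have hm0 : (m : ℚ) ≠ 0 := Nat.cast_ne_zero.2 (by rintro rfl; simp at hm)
  simpa [hm0] using mul_mem_pIdeal (inv_natCast_mem_pIntegral hm) h

theorem mem_pIdeal_of_dvd {k : ℕ} {z : ℤ} (h : (p : ℤ) ^ k ∣ z) : (z : ℚ) ∈ pIdeal p k := by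
  obtain ⟨c, rfl⟩ := h
  exact ⟨c, intCast_mem _ c, by push_cast; ring⟩

theorem mul_sub_mul_mem_pIdeal {k : ℕ} {a b c d : ℚ} (hc : c ∈ pIntegral p) (hb : b ∈ pIntegral p)
    (h₁ : a - b ∈ pIdeal p k) (h₂ : c - d ∈ pIdeal p k) : a * c - b * d ∈ pIdeal p k := by
  rw [show a * c - b * d = c * (a - b) + b * (c - d) by ring]
  exact add_mem (mul_mem_pIdeal hc h₁) (mul_mem_pIdeal hb h₂)

theorem sum_sub_sum_mem_pIdeal {ι : Type*} {k : ℕ} {s : Finset ι} {f g : ι → ℚ}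
    (h : ∀ i ∈ s, f i - g i ∈ pIdeal p k) : ∑ i ∈ s, f i - ∑ i ∈ s, g i ∈ pIdeal p k := by
  rw [← Finset.sum_sub_distrib]
  exact sum_mem h

end

/-! ### Exact acceleration identities for the two binomial sums -/

/-- The product `∏ (1 - y² / (2j+1)²)⁻¹` over the first `k` odd numbers. -/
def oddProd (y : ℚ) (k : ℕ) : ℚ := ∏ j ∈ range k, (1 - y ^ 2 / (2 * (j : ℚ) + 1) ^ 2)⁻¹

/-- The remainder term of the accelerated alternating series over odd numbers. -/
def oddTerm (y : ℚ) (k : ℕ) : ℚ := oddProd y k / (2 * (y - (2 * k + 1)))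

theorem oddProd_zero (y : ℚ) : oddProd y 0 = 1 := by simp [oddProd]

theorem oddProd_succ (y : ℚ) (k : ℕ) :
    oddProd y (k + 1) = oddProd y k * (1 - y ^ 2 / (2 * (k : ℚ) + 1) ^ 2)⁻¹ := prod_range_succ _ _

theorem inv_one_sub_div_odd {y : ℚ} {k : ℕ} (hy : (2 * k + 1 : ℚ) < y) :
    (1 - y ^ 2 / (2 * (k : ℚ) + 1) ^ 2)⁻¹ =
      -(2 * (k : ℚ) + 1) ^ 2 / ((y - (2 * k + 1)) * (y + (2 * k + 1))) := by
  have hk : (0 : ℚ) < 2 * k + 1 := by positivity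
  have h1 : y - (2 * k + 1) ≠ 0 := by linarith
  have h2 : y + (2 * k + 1) ≠ 0 := by linarith
  rw [show 1 - y ^ 2 / (2 * (k : ℚ) + 1) ^ 2 =
    -((y - (2 * k + 1)) * (y + (2 * k + 1))) / (2 * (k : ℚ) + 1) ^ 2 by field_simp; ring]
  rw [inv_div, neg_div, div_neg]

/-- Each factor splits as `(2j+1-y)(2j+1+y)/(2j+1)²`, so shifting `y` by 2 cancels all but the
boundary factors. The bound on `y` keeps the denominators nonzero. -/
theorem oddProd_add_two (y : ℚ) (k : ℕ) (hy : (2 * k : ℚ) < y + 1) :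
    oddProd (y + 2) k * (y + 2 * k + 1) = oddProd y k * (y - 2 * k + 1) := by
  induction k with
  | zero => simp [oddProd_zero]
  | succ k ih =>
    push_cast at hy
    have hk : (0 : ℚ) ≤ k := k.cast_nonneg
    specialize ih (by linarith)
    rw [oddProd_succ, oddProd_succ, inv_one_sub_div_odd (by linarith),
      inv_one_sub_div_odd (by linarith)]
    have h1 : y - (2 * k + 1) ≠ 0 := by linarith
    have h2 : y + (2 * k + 1) ≠ 0 := by linarith
    have h3 : y + 2 - (2 * k + 1) ≠ 0 := by linarith
    have h4 : y + 2 + (2 * k + 1) ≠ 0 := by linarith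
    push_cast
    field_simp
    linear_combination (-(y + 2 * (k + 1) + 1) * (y - (2 * k + 1))) * ih

theorem oddTerm_add_two (y : ℚ) (k : ℕ) (hy : (2 * k : ℚ) < y + 1) :
    oddTerm (y + 2) k = oddProd y k / (2 * (y + (2 * k + 1))) := by
  have hk : (0 : ℚ) ≤ k := k.cast_nonneg
  have h := oddProd_add_two y k hy
  have h2 : y + (2 * k + 1) ≠ 0 := by linarith
  have h3 : y + 2 - (2 * k + 1) ≠ 0 := by linarith
  rw [oddTerm, div_eq_div_iff (by positivity) (by positivity)]
  linear_combination 2 * h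

/-- The summand is `(oddProd y k - oddProd y (k+1)) / y²`, so the sum telescopes. -/
theorem sum_oddProd_div (y : ℚ) (K : ℕ) (hy : (2 * K : ℚ) < y + 1) (hy0 : y ≠ 0) :
    ∑ k ∈ range K, oddProd y k / ((y - (2 * k + 1)) * (y + (2 * k + 1))) =
      (1 - oddProd y K) / y ^ 2 := by
  induction K with
  | zero => simp [oddProd_zero]
  | succ k ih =>
    push_cast at hy
    have hk : (0 : ℚ) ≤ k := k.cast_nonneg
    rw [sum_range_succ, ih (by linarith), oddProd_succ, inv_one_sub_div_odd (by linarith)]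
    have h1 : y - (2 * k + 1) ≠ 0 := by linarith
    have h2 : y + (2 * k + 1) ≠ 0 := by linarith
    field_simp
    ring

theorem oddTerm_add_oddTerm (y : ℚ) (k : ℕ) (hy : (2 * k + 1 : ℚ) < y) :
    oddTerm y k + oddTerm (y + 2) k =
      y * (oddProd y k / ((y - (2 * k + 1)) * (y + (2 * k + 1)))) := by
  have hk : (0 : ℚ) ≤ k := k.cast_nonneg
  have h1 : y - (2 * k + 1) ≠ 0 := by linarith
  have h2 : y + (2 * k + 1) ≠ 0 := by linarith
  rw [oddTerm_add_two y k (by linarith), oddTerm]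
  field_simp
  ring

theorem oddTerm_sub_oddTerm (y : ℚ) (k : ℕ) (hy : (2 * k + 1 : ℚ) < y) :
    oddTerm y k / (2 * k + 1) - oddTerm (y + 2) k / (2 * k + 1) =
      oddProd y k / ((y - (2 * k + 1)) * (y + (2 * k + 1))) := by
  have hk : (0 : ℚ) ≤ k := k.cast_nonneg
  have h1 : y - (2 * k + 1) ≠ 0 := by linarith
  have h2 : y + (2 * k + 1) ≠ 0 := by linarith
  rw [oddTerm_add_two y k (by linarith), oddTerm]
  field_simp
  ring

theorem oddProd_eq_choose (N : ℕ) :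
    oddProd (2 * N + 1) N = (-1) ^ N * ((2 * N).choose N / 16 ^ N) := by
  induction N with
  | zero => simp [oddProd_zero]
  | succ N ih =>
    have h := oddProd_add_two (2 * N + 1) N (by linarith)
    have hc : ((N : ℚ) + 1) * ((2 * (N + 1)).choose (N + 1) : ℕ) =
        2 * (2 * N + 1) * ((2 * N).choose N : ℕ) := by
      exact_mod_cast Nat.succ_mul_centralBinom_succ N
    have hN : (0 : ℚ) ≤ N := N.cast_nonneg
    have hN1 : (N : ℚ) + 1 ≠ 0 := by positivity
    rw [ih] at h
    rw [oddProd_succ, show (2 * ((N + 1 : ℕ) : ℚ) + 1) = 2 * N + 1 + 2 by push_cast; ring,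
      inv_one_sub_div_odd (by linarith),
      show oddProd (2 * (N : ℚ) + 1 + 2) N =
        (-1) ^ N * (((2 * N).choose N : ℕ) / 16 ^ N) / (2 * N + 1) by
          field_simp at h ⊢; linarith,
      eq_div_of_mul_eq hN1 ((mul_comm _ _).trans hc)]
    have h3 : (2 * (N : ℚ) + 1 + 2 + (2 * N + 1)) ≠ 0 := by positivity
    have h4 : (2 * (N : ℚ) + 1 + 2 - (2 * N + 1)) = 2 := by ring
    rw [h4]
    field_simp
    ring

theorem oddTerm_last (N : ℕ) :
    oddTerm (2 * N + 1 + 2) N = oddProd (2 * N + 1) N / (4 * (2 * N + 1)) := by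
  rw [oddTerm_add_two _ _ (by linarith)]
  congr 1
  ring

/-- Passing from `N` to `N + 1` moves `y = 2N+1` to `y + 2`, and the two rows of `oddTerm` add up to
a telescoping sum. This cancels the new term of the alternating sum except for `oddProd y N / y`.
The new last `oddTerm` removes a quarter of it, whence `3/4`. -/
theorem sum_choose_div_sixteen_pow (N : ℕ) :
    (3 / 4 : ℚ) * ∑ k ∈ range N, ((2 * k).choose k : ℚ) / (16 ^ k * (2 * k + 1)) =
      ∑ k ∈ range N, (-1) ^ k / (2 * (k : ℚ) + 1) +
        (-1) ^ N * ∑ k ∈ range N, oddTerm (2 * N + 1) k := by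
  induction N with
  | zero => simp
  | succ N ih =>
    have hN : (0 : ℚ) ≤ N := N.cast_nonneg
    have hy : (2 * N + 1 : ℚ) ≠ 0 := by positivity
    have key : ∑ k ∈ range N, oddTerm (2 * N + 1) k + ∑ k ∈ range N, oddTerm (2 * N + 1 + 2) k =
        (1 - oddProd (2 * N + 1) N) / (2 * N + 1) := by
      rw [← sum_add_distrib, sum_congr rfl fun k hk => oddTerm_add_oddTerm _ k ?_, ← mul_sum,
        sum_oddProd_div _ _ (by linarith) hy]
      · field_simp
      · have : (k : ℚ) < N := by exact_mod_cast mem_range.1 hk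
        linarith
    have e : (2 * ((N + 1 : ℕ) : ℚ) + 1) = 2 * N + 1 + 2 := by push_cast; ring
    have hs : ((-1 : ℚ) ^ N) ^ 2 = 1 := by rw [← pow_mul, mul_comm, pow_mul]; norm_num
    rw [sum_range_succ, sum_range_succ, mul_add, ih, e, sum_range_succ, oddTerm_last,
      eq_sub_of_add_eq' key, oddProd_eq_choose, pow_succ]
    field_simp
    linear_combination (-3 * (((2 * N).choose N : ℕ) : ℚ)) * hs

/-- The same argument with the difference of consecutive rows; the last `oddTerm` now enters with
the opposite sign, so `1 + 1/4` replaces `1 - 1/4`. -/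
theorem sum_choose_div_neg_sixteen_pow (N : ℕ) :
    (5 / 4 : ℚ) * ∑ k ∈ range N, ((2 * k).choose k : ℚ) / ((-16) ^ k * (2 * k + 1) ^ 2) =
      ∑ k ∈ range N, 1 / (2 * (k : ℚ) + 1) ^ 2 +
        ∑ k ∈ range N, oddTerm (2 * N + 1) k / (2 * k + 1) := by
  induction N with
  | zero => simp
  | succ N ih =>
    have hN : (0 : ℚ) ≤ N := N.cast_nonneg
    have hy : (2 * N + 1 : ℚ) ≠ 0 := by positivity
    have key : ∑ k ∈ range N, oddTerm (2 * N + 1) k / (2 * k + 1) -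
        ∑ k ∈ range N, oddTerm (2 * N + 1 + 2) k / (2 * k + 1) =
        (1 - oddProd (2 * N + 1) N) / (2 * N + 1) ^ 2 := by
      rw [← sum_sub_distrib, sum_congr rfl fun k hk => oddTerm_sub_oddTerm _ k ?_,
        sum_oddProd_div _ _ (by linarith) hy]
      have : (k : ℚ) < N := by exact_mod_cast mem_range.1 hk
      linarith
    have e : (2 * ((N + 1 : ℕ) : ℚ) + 1) = 2 * N + 1 + 2 := by push_cast; ring
    have h16 : (-16 : ℚ) ^ N = (-1) ^ N * 16 ^ N := by rw [← mul_pow]; norm_num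
    have hs : ((-1 : ℚ) ^ N) ^ 2 = 1 := by rw [← pow_mul, mul_comm, pow_mul]; norm_num
    rw [sum_range_succ, sum_range_succ, mul_add, ih, e, sum_range_succ, oddTerm_last,
      eq_sub_of_add_eq' (sub_eq_iff_eq_add.1 key).symm, oddProd_eq_choose, h16]
    field_simp
    linear_combination (-5 * (((2 * N).choose N : ℕ) : ℚ)) * hs

/-! ### A finite product identity with a parameter -/

/-- The product `∏ (n - i) / (n + 1 + i - q)` over `i < l`; for `q = 0` it is
`(n!)² / ((n - l)! (n + l)!)`. -/
def shiftedRatio (q : ℚ) (n l : ℕ) : ℚ := ∏ i ∈ range l, ((n : ℚ) - i) / (n + 1 + i - q)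

theorem shiftedRatio_succ (q : ℚ) (n l : ℕ) :
    shiftedRatio q n (l + 1) = shiftedRatio q n l * (((n : ℚ) - l) / (n + 1 + l - q)) :=
  prod_range_succ _ _

theorem shiftedRatio_zero (q : ℚ) (n : ℕ) : shiftedRatio q n 0 = 1 := by simp [shiftedRatio]

theorem shiftedRatio_self_succ (q : ℚ) (n : ℕ) : shiftedRatio q n (n + 1) = 0 := by
  simp [shiftedRatio_succ]

theorem shiftedRatio_pred {q : ℚ} {n l : ℕ} (hl : l ≤ n + 1)
    (hq : ∀ j : ℕ, 1 ≤ j → j ≤ 2 * (n + 1) → (j : ℚ) - q ≠ 0) :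
    shiftedRatio q n l * (((n : ℚ) + 1) * (n + 1 - q)) =
      shiftedRatio q (n + 1) l * ((n + 1 - l) * (n + 1 + l - q)) := by
  induction l with
  | zero => simp [shiftedRatio_zero]
  | succ l ih =>
    specialize ih (by omega)
    have h1 : (n : ℚ) + 1 + l - q ≠ 0 := by
      have := hq (n + 1 + l) (by omega) (by omega)
      push_cast at this; exact this
    have h2 : (n : ℚ) + 1 + 1 + l - q ≠ 0 := by
      have := hq (n + 1 + 1 + l) (by omega) (by omega)
      push_cast at this; exact this
    rw [shiftedRatio_succ, shiftedRatio_succ]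
    push_cast
    have h3 : (n : ℚ) + 1 + (l + 1) - q ≠ 0 := by
      rwa [show (n : ℚ) + 1 + (l + 1) - q = n + 1 + 1 + l - q by ring]
    rw [show (n : ℚ) + 1 + (l + 1) - q = n + 1 + 1 + l - q by ring]
    rw [show shiftedRatio q n l * (((n : ℚ) - l) / (n + 1 + l - q)) * ((n + 1) * (n + 1 - q)) =
      (shiftedRatio q n l * ((n + 1) * (n + 1 - q))) * (((n : ℚ) - l) / (n + 1 + l - q)) by ring, ih]
    field_simp
    ring

/-- With `R_m = shiftedRatio q n m`, the summand is `R_l (n-l) - R_{l+1} (n-l-1)`. -/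
theorem sum_mul_shiftedRatio {q : ℚ} {n : ℕ}
    (hq : ∀ j : ℕ, 1 ≤ j → j ≤ 2 * n → (j : ℚ) - q ≠ 0) :
    ∑ l ∈ range n, (2 * ((l : ℚ) + 1) - q) * shiftedRatio q n (l + 1) = n := by
  have key : ∀ m ≤ n, ∑ l ∈ range m, (2 * ((l : ℚ) + 1) - q) * shiftedRatio q n (l + 1) =
      n - shiftedRatio q n m * (n - m) := by
    intro m hm
    induction m with
    | zero => simp [shiftedRatio_zero]
    | succ m ih =>
      have h1 : (n : ℚ) + 1 + m - q ≠ 0 := by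
        have := hq (n + 1 + m) (by omega) (by omega)
        push_cast at this; exact this
      rw [sum_range_succ, ih (by omega), shiftedRatio_succ]
      push_cast
      field_simp
      ring
  rw [key n le_rfl]
  ring

/-- It is used at `q = 0`, as the base case of `starSum_eq`, and at `q = p`, where the ratios become
signs. -/
theorem sum_prod_eq_prod_mul_sum_shiftedRatio {q : ℚ} {n : ℕ}
    (hq : ∀ j : ℕ, 1 ≤ j → j ≤ 2 * n → (j : ℚ) - q ≠ 0) :
    ∑ i ∈ range n, 1 / ((i : ℚ) + 1 - q) *
        ∏ j ∈ range i, (1 + q ^ 2 / 4 / (((j : ℚ) + 1) * (j + 1 - q))) =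
      (∏ j ∈ range n, (1 + q ^ 2 / 4 / (((j : ℚ) + 1) * (j + 1 - q)))) *
        ∑ l ∈ range n, 4 / (2 * ((l : ℚ) + 1) - q) * shiftedRatio q n (l + 1) := by
  induction n with
  | zero => simp
  | succ n ih =>
    have h1 : (n : ℚ) + 1 - q ≠ 0 := by
      have := hq (n + 1) (by omega) (by omega)
      push_cast at this; exact this
    have h0 : (n : ℚ) + 1 ≠ 0 := by positivity
    have step : (1 + q ^ 2 / 4 / (((n : ℚ) + 1) * (n + 1 - q))) *
        ∑ l ∈ range (n + 1), 4 / (2 * ((l : ℚ) + 1) - q) * shiftedRatio q (n + 1) (l + 1) -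
        ∑ l ∈ range (n + 1), 4 / (2 * ((l : ℚ) + 1) - q) * shiftedRatio q n (l + 1) =
        1 / (n + 1 - q) := by
      have e := sum_mul_shiftedRatio hq
      push_cast at e
      rw [mul_sum, ← sum_sub_distrib]
      -- With `m = l + 1`, `(n+1-m)(n+1+m-q) = (n+1)(n+1-q) - m(m-q)` and `m(m-q) + q²/4 =
      -- (2m-q)²/4`; one factor `2m-q` cancels and `sum_mul_shiftedRatio` applies.
      calc _ = ∑ l ∈ range (n + 1), (2 * ((l : ℚ) + 1) - q) * shiftedRatio q (n + 1) (l + 1) /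
            ((n + 1) * (n + 1 - q)) := by
            refine sum_congr rfl fun l hl => ?_
            have hl' := mem_range.1 hl
            have h2 : 2 * ((l : ℚ) + 1) - q ≠ 0 := by
              have := hq (2 * (l + 1)) (by omega) (by omega)
              push_cast at this; exact this
            have e2 := shiftedRatio_pred (q := q) (n := n) (l := l + 1) (by omega) hq
            push_cast at e2
            rw [← eq_div_iff (mul_ne_zero h0 h1)] at e2
            rw [e2]
            field_simp
            ring
        _ = _ := by
            rw [← sum_div, e]
            field_simp
    rw [sum_range_succ, ih fun j h2 h3 => hq j h2 (by omega), prod_range_succ]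
    rw [sum_range_succ _ n, sum_range_succ _ n, shiftedRatio_self_succ] at step
    rw [sum_range_succ _ n]
    linear_combination (-∏ j ∈ range n, (1 + q ^ 2 / 4 / (((j : ℚ) + 1) * (j + 1 - q)))) * step

/-! ### Star sums and strict sums -/

/-- The star sum `∑ 1 / (i₁ i₂² ⋯ i_{a+1}²)` over `1 ≤ i₁ ≤ ⋯ ≤ i_{a+1} ≤ n`. -/
def starSum : ℕ → ℕ → ℚ
  | 0, n => ∑ i ∈ range n, ((i : ℚ) + 1)⁻¹
  | a + 1, n => ∑ i ∈ range n, ((i : ℚ) + 1)⁻¹ ^ 2 * starSum a (i + 1)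

/-- Induction on the depth and on `n`: for `q = 0`, `shiftedRatio_pred` says that the increment of
the ratio from `n` to `n + 1` is `m²/(n+1)²` times the new ratio, with `m = l + 1`. That is the
extra factor `1/(n+1)²` of the star sum. -/
theorem starSum_eq (a n : ℕ) :
    starSum a n = 2 * ∑ l ∈ range n, shiftedRatio 0 n (l + 1) * ((l : ℚ) + 1)⁻¹ ^ (2 * a + 1) := by
  have hq : ∀ n j : ℕ, 1 ≤ j → j ≤ 2 * n → (j : ℚ) - 0 ≠ 0 := fun n j h _ => by
    rw [sub_zero]; exact_mod_cast (by omega : j ≠ 0)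
  induction a generalizing n with
  | zero =>
    have h := sum_prod_eq_prod_mul_sum_shiftedRatio (hq n)
    simp only [sub_zero, ne_eq, OfNat.ofNat_ne_zero, not_false_eq_true, zero_pow, zero_div,
      add_zero, prod_const_one, mul_one, one_mul] at h
    simp only [starSum, ← one_div, h, mul_sum, mul_zero, zero_add, pow_one]
    refine sum_congr rfl fun l _ => ?_
    have : (l : ℚ) + 1 ≠ 0 := by positivity
    field_simp
    ring
  | succ a ih =>
    induction n with
    | zero => simp [starSum]
    | succ n ihn =>
      have e : starSum (a + 1) (n + 1) =
          starSum (a + 1) n + ((n : ℚ) + 1)⁻¹ ^ 2 * starSum a (n + 1) := by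
        simp only [starSum]; rw [sum_range_succ]
      have e2 : ∑ l ∈ range n, shiftedRatio 0 n (l + 1) * ((l : ℚ) + 1)⁻¹ ^ (2 * (a + 1) + 1) =
          ∑ l ∈ range (n + 1), shiftedRatio 0 n (l + 1) * ((l : ℚ) + 1)⁻¹ ^ (2 * (a + 1) + 1) := by
        rw [sum_range_succ, shiftedRatio_self_succ]; simp
      rw [e, ihn, ih, e2, mul_left_comm, ← mul_add, mul_sum, ← sum_add_distrib]
      congr 1
      refine sum_congr rfl fun l hl => ?_
      have hl' := mem_range.1 hl
      have e3 := shiftedRatio_pred (q := 0) (n := n) (l := l + 1) (by omega) (hq (n + 1))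
      have h0 : (n : ℚ) + 1 ≠ 0 := by positivity
      have hl0 : (l : ℚ) + 1 ≠ 0 := by positivity
      push_cast at e3
      rw [← eq_div_iff (by simpa using h0)] at e3
      rw [e3, show 2 * (a + 1) + 1 = (2 * a + 1) + 2 by ring, pow_add _ (2 * a + 1) 2]
      field_simp
      ring

/-- The strict sum `∑ 1 / (j² k² i)` over `1 ≤ j < k < i ≤ n`. -/
def strictSum (n : ℕ) : ℚ :=
  ∑ i ∈ range n, ((i : ℚ) + 1)⁻¹ * ∑ k ∈ range i, ((k : ℚ) + 1)⁻¹ ^ 2 *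
    ∑ j ∈ range k, ((j : ℚ) + 1)⁻¹ ^ 2

/-- For `x_j = 1/j²`, multiplying the generating function of the complete symmetric functions of the
`x_j` with `j ≥ i` by that of the elementary ones of all `x_j` leaves the elementary ones of the
`x_j` with `j < i`. This is its degree 2 part, weighted by `1/i`. -/
theorem strictSum_eq_starSum (n : ℕ) :
    strictSum n = starSum 2 n - (∑ i ∈ range n, ((i : ℚ) + 1)⁻¹ ^ 2) * starSum 1 n +
      (∑ k ∈ range n, ((k : ℚ) + 1)⁻¹ ^ 2 * ∑ j ∈ range k, ((j : ℚ) + 1)⁻¹ ^ 2) *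
        starSum 0 n := by
  induction n with
  | zero => simp [strictSum, starSum]
  | succ n ih =>
    simp only [strictSum, starSum] at ih ⊢
    simp only [sum_range_succ _ n]
    linear_combination ih

/-! ### Reflection and parity splittings, and inverse power sums -/

theorem sum_range_two_mul_eq_sum_reflect (f : ℕ → ℚ) (n : ℕ) :
    ∑ k ∈ range (2 * n), f (k + 1) = ∑ l ∈ range n, (f (l + 1) + f (2 * n - l)) := by
  rw [two_mul, sum_range_add, sum_add_distrib, ← sum_range_reflect (fun l => f (n + l + 1))]
  congr 1
  refine sum_congr rfl fun l hl => ?_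
  have := mem_range.1 hl
  congr 1
  omega

theorem sum_range_two_mul_eq_sum_parity (f : ℕ → ℚ) (n : ℕ) :
    ∑ k ∈ range (2 * n), f (k + 1) =
      ∑ l ∈ range n, (f (2 * (l + 1)) + f (2 * n - 1 - 2 * l)) := by
  have h : ∑ k ∈ range (2 * n), f (k + 1) =
      ∑ l ∈ range n, f (2 * (l + 1)) + ∑ l ∈ range n, f (2 * l + 1) := by
    induction n with
    | zero => simp
    | succ n ih =>
      rw [show 2 * (n + 1) = 2 * n + 1 + 1 by ring, sum_range_succ, sum_range_succ, ih,
        sum_range_succ, sum_range_succ, show 2 * (n + 1) = 2 * n + 1 + 1 by ring]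
      ring
  rw [h, sum_add_distrib, ← sum_range_reflect (fun l => f (2 * l + 1))]
  congr 1
  refine sum_congr rfl fun l hl => ?_
  have := mem_range.1 hl
  congr 1
  omega

/-- The inverse of `l + 1`. -/
def invSucc (l : ℕ) : ℚ := ((l : ℚ) + 1)⁻¹

/-- The inverse of `p - (l + 1)`. -/
def invSub (p l : ℕ) : ℚ := ((p : ℚ) - (l + 1))⁻¹

/-- The inverse of `p - 2 (l + 1)`. -/
def invSubTwo (p l : ℕ) : ℚ := ((p : ℚ) - 2 * (l + 1))⁻¹

/-- The sum of `1 / k ^ s` over `1 ≤ k ≤ n`. -/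
def invPowSum (n s : ℕ) : ℚ := ∑ l ∈ range n, invSucc l ^ s

/-- The sum of `1 / (j ^ a * i ^ b)` over `1 ≤ j < i ≤ n`. -/
def invPowSum₂ (n a b : ℕ) : ℚ := ∑ i ∈ range n, invSucc i ^ b * invPowSum i a

theorem succ_mul_invSucc (l : ℕ) : ((l : ℚ) + 1) * invSucc l = 1 :=
  mul_inv_cancel₀ (by positivity)

theorem sub_mul_invSub {p l : ℕ} (h : l + 1 < p) : ((p : ℚ) - (l + 1)) * invSub p l = 1 := by
  have : (l : ℚ) + 1 < p := by exact_mod_cast h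
  exact mul_inv_cancel₀ (by linarith)

theorem sub_mul_invSubTwo {p l : ℕ} (h : 2 * (l + 1) < p) :
    ((p : ℚ) - 2 * (l + 1)) * invSubTwo p l = 1 := by
  have : 2 * ((l : ℚ) + 1) < p := by exact_mod_cast h
  exact mul_inv_cancel₀ (by linarith)

theorem invSub_eq {p l : ℕ} (h : l + 1 < p) :
    invSub p l = -invSucc l + p * invSucc l * invSub p l := by
  linear_combination (-invSucc l) * sub_mul_invSub h - invSub p l * succ_mul_invSucc l

theorem invSubTwo_eq {p l : ℕ} (h : 2 * (l + 1) < p) :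
    invSubTwo p l = -(invSucc l / 2) + p * (invSucc l / 2) * invSubTwo p l := by
  linear_combination (-invSucc l / 2) * sub_mul_invSubTwo h - invSubTwo p l * succ_mul_invSucc l

section

variable {p n : ℕ} [hp : Fact p.Prime]

theorem invSucc_mem {l : ℕ} (h : l + 1 < p) : invSucc l ∈ pIntegral p := by
  have := inv_natCast_mem_pIntegral (p := p) (m := l + 1)
    (Nat.not_dvd_of_pos_of_lt l.succ_pos h)
  simpa [invSucc] using this

theorem invSub_mem {l : ℕ} (h : l + 1 < p) : invSub p l ∈ pIntegral p := by
  have := inv_natCast_mem_pIntegral (p := p) (m := p - (l + 1))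
    (Nat.not_dvd_of_pos_of_lt (by omega) (by omega))
  rw [Nat.cast_sub h.le] at this
  simpa [invSub] using this

theorem invSubTwo_mem {l : ℕ} (h : 2 * (l + 1) < p) : invSubTwo p l ∈ pIntegral p := by
  have := inv_natCast_mem_pIntegral (p := p) (m := p - 2 * (l + 1))
    (Nat.not_dvd_of_pos_of_lt (by omega) (by omega))
  rw [Nat.cast_sub h.le] at this
  simpa [invSubTwo] using this

theorem invPowSum_mem {i : ℕ} (hi : i < p) (s : ℕ) : invPowSum i s ∈ pIntegral p :=
  sum_mem fun l hl => pow_mem (invSucc_mem (by have := mem_range.1 hl; omega)) s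

theorem invPowSum₂_mem {i : ℕ} (hi : i < p) (a b : ℕ) : invPowSum₂ i a b ∈ pIntegral p :=
  sum_mem fun l hl => by
    have := mem_range.1 hl
    exact mul_mem (pow_mem (invSucc_mem (by omega)) b) (invPowSum_mem (by omega) a)

/-- The constants cleared from denominators have only the prime factors 2, 3 and 5. -/
theorem not_dvd_of_smooth (h5 : 5 < p) (a b c : ℕ) : ¬ p ∣ 2 ^ a * 3 ^ b * 5 ^ c := by
  intro h
  have key : ∀ q k : ℕ, 0 < q → q < 6 → p ∣ q ^ k → False := fun q k h0 h6 hd =>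
    absurd (Nat.le_of_dvd h0 (hp.out.dvd_of_dvd_pow hd)) (by omega)
  rcases hp.out.dvd_mul.1 h with h | h
  · rcases hp.out.dvd_mul.1 h with h | h
    · exact key 2 a (by norm_num) (by norm_num) h
    · exact key 3 b (by norm_num) (by norm_num) h
  · exact key 5 c (by norm_num) (by norm_num) h

theorem inv_two_mem (h5 : 5 < p) : (2 : ℚ)⁻¹ ∈ pIntegral p := by
  simpa using inv_natCast_mem_pIntegral (not_dvd_of_smooth h5 1 0 0)

theorem half_invSucc_mem (h5 : 5 < p) {l : ℕ} (h : l + 1 < p) : invSucc l / 2 ∈ pIntegral p := by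
  rw [div_eq_mul_inv]
  exact mul_mem (invSucc_mem h) (inv_two_mem h5)

/-! ### Power sums -/

theorem succ_pow_card_sub_one_sub_one_mem {l : ℕ} (h : l + 1 < p) :
    ((l : ℚ) + 1) ^ (p - 1) - 1 ∈ pIdeal p 1 := by
  have hcop : IsCoprime ((l + 1 : ℕ) : ℤ) p := Nat.isCoprime_iff_coprime.2
    (Nat.coprime_of_lt_prime l.succ_ne_zero h hp.out).symm
  have hd : (p : ℤ) ^ 1 ∣ ((l + 1 : ℕ) : ℤ) ^ (p - 1) - 1 := by
    rw [pow_one]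
    exact (Int.ModEq.pow_card_sub_one_eq_one hp.out hcop).symm.dvd
  have := mem_pIdeal_of_dvd hd
  push_cast at this
  exact this

/-- The recursion for `bernoulli' s` divides only by integers up to `s + 1`, which is less than `p`.
-/
theorem bernoulli_mem {s : ℕ} (hs : s + 1 < p) : bernoulli s ∈ pIntegral p := by
  have key : ∀ s : ℕ, s + 1 < p → bernoulli' s ∈ pIntegral p := by
    intro s
    induction s using Nat.strong_induction_on with
    | _ s ih =>
      intro hs
      rw [bernoulli'_def]
      refine sub_mem (one_mem _) (sum_mem fun k hk => ?_)
      have hk' := mem_range.1 hk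
      rw [div_eq_mul_inv, mul_right_comm]
      refine mul_mem (mul_mem (natCast_mem _ _) (ih k hk' (by omega))) ?_
      have := inv_natCast_mem_pIntegral (p := p) (m := s - k + 1)
        (Nat.not_dvd_of_pos_of_lt (by omega) (by omega))
      rw [Nat.cast_add, Nat.cast_sub hk'.le] at this
      simpa using this
  rw [bernoulli]
  exact mul_mem (pow_mem (neg_mem (one_mem _)) _) (key s hs)

theorem sum_pow_mem_pIdeal {e : ℕ} (he : ¬ (p - 1) ∣ e) :
    ∑ k ∈ range (p - 1), ((k : ℚ) + 1) ^ e ∈ pIdeal p 1 := by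
  have h1 : ∑ v ∈ Ico 1 p, (v : ZMod p) ^ e = ∑ u : (ZMod p)ˣ, (u : ZMod p) ^ e :=
    Finset.sum_bij'
      (fun v hv => Units.mk0 (v : ZMod p) (mt (ZMod.natCast_eq_zero_iff v p).mp
        (Nat.not_dvd_of_pos_of_lt (mem_Ico.1 hv).1 (mem_Ico.1 hv).2)))
      (fun u _ => (u : ZMod p).val)
      (fun _ _ => Finset.mem_univ _)
      (fun u _ => mem_Ico.2
        ⟨Nat.pos_of_ne_zero ((ZMod.val_ne_zero _).2 u.ne_zero), ZMod.val_lt _⟩)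
      (fun v hv => by simp [ZMod.val_cast_of_lt (Finset.mem_Ico.mp hv).2])
      (fun u _ => Units.ext (ZMod.natCast_zmod_val _))
      (fun _ _ => rfl)
  rw [FiniteField.sum_pow_units, ZMod.card, if_neg he, sum_Ico_eq_sum_range] at h1
  have h2 : (p : ℤ) ^ 1 ∣ ∑ k ∈ range (p - 1), ((k : ℤ) + 1) ^ e := by
    rw [pow_one, ← ZMod.intCast_zmod_eq_zero_iff_dvd]
    push_cast at h1 ⊢
    rw [← h1]
    exact sum_congr rfl fun k _ => by rw [add_comm]
  have := mem_pIdeal_of_dvd h2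
  push_cast at this
  exact this

/-- For even `e` the powers of `l` and `p - l` agree modulo `p`, so the full sum is twice the half
sum. -/
theorem sum_pow_half_mem_pIdeal (hpn : p = 2 * n + 1) {e : ℕ} (h5 : 5 < p) (he : ¬ (p - 1) ∣ e)
    (heven : Even e) : ∑ l ∈ range n, ((l : ℚ) + 1) ^ e ∈ pIdeal p 1 := by
  have h := sum_pow_mem_pIdeal he
  have h2 := sum_range_two_mul_eq_sum_reflect (fun k => (k : ℚ) ^ e) n
  rw [show p - 1 = 2 * n by omega] at h
  push_cast at h2
  rw [h2] at h
  have h3 : ∑ l ∈ range n, (((l : ℚ) + 1) ^ e + ((2 * n - l : ℕ) : ℚ) ^ e) -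
      ∑ l ∈ range n, (2 * ((l : ℚ) + 1) ^ e) ∈ pIdeal p 1 := by
    refine sum_sub_sum_mem_pIdeal fun l hl => ?_
    have hl' := mem_range.1 hl
    have hd : (p : ℤ) ^ 1 ∣ ((2 * n - l : ℕ) : ℤ) ^ e - ((l + 1 : ℕ) : ℤ) ^ e := by
      rw [pow_one, ← heven.neg_pow ((l + 1 : ℕ) : ℤ)]
      refine dvd_trans ⟨1, ?_⟩ (sub_dvd_pow_sub_pow _ _ e)
      rw [Nat.cast_sub (by omega), hpn]
      push_cast
      ring
    have := mem_pIdeal_of_dvd hd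
    push_cast at this
    convert this using 1
    ring
  refine mem_pIdeal_of_natCast_mul_mem (m := 2) (not_dvd_of_smooth h5 1 0 0) ?_
  convert sub_mem h h3 using 1
  rw [← mul_sum]
  push_cast
  ring

theorem invSucc_pow_sub_mem {l s : ℕ} (h : l + 1 < p) (hs : s ≤ p - 1) :
    invSucc l ^ s - ((l : ℚ) + 1) ^ (p - 1 - s) ∈ pIdeal p 1 := by
  have h1 := mul_mem_pIdeal (neg_mem (pow_mem (invSucc_mem h) s))
    (succ_pow_card_sub_one_sub_one_mem h)
  convert h1 using 1
  rw [show ((l : ℚ) + 1) ^ (p - 1) = ((l : ℚ) + 1) ^ (p - 1 - s) * ((l : ℚ) + 1) ^ s by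
    rw [← pow_add]; congr 1; omega]
  have e : ((l : ℚ) + 1) ^ s * invSucc l ^ s = 1 := by
    rw [← mul_pow, succ_mul_invSucc, one_pow]
  linear_combination (((l : ℚ) + 1) ^ (p - 1 - s)) * e

/-- In Faulhaber's formula the linear term is `p B_{p-5}`, and every other term carries `p²`. -/
theorem sum_pow_sub_five_sub_bernoulli_mem (h5 : 5 < p) :
    ∑ k ∈ range (p - 1), ((k : ℚ) + 1) ^ (p - 5) - p * bernoulli (p - 5) ∈ pIdeal p 2 := by
  have h := sum_range_pow p (p - 5)
  rw [show p = p - 1 + 1 by omega, sum_range_succ', show p - 1 + 1 = p by omega] at h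
  push_cast at h
  rw [zero_pow (by omega), add_zero] at h
  have hinv : (((p - 5 : ℕ) : ℚ) + 1)⁻¹ ∈ pIntegral p := by
    have := inv_natCast_mem_pIntegral (p := p) (m := p - 5 + 1)
      (Nat.not_dvd_of_pos_of_lt (by omega) (by omega))
    push_cast at this
    exact this
  have h0 : ((p - 5 : ℕ) : ℚ) + 1 ≠ 0 := by positivity
  rw [h, sum_range_succ, Nat.choose_succ_self_right, show p - 5 + 1 - (p - 5) = 1 by omega]
  push_cast
  rw [show ∀ x : ℚ, x + bernoulli (p - 5) * (((p - 5 : ℕ) : ℚ) + 1) * (p : ℚ) ^ 1 /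
    (((p - 5 : ℕ) : ℚ) + 1) - p * bernoulli (p - 5) = x by intro x; field_simp; ring]
  refine sum_mem fun s hs => ?_
  have hs' := mem_range.1 hs
  refine mem_pIdeal_of_eq (c := bernoulli s * ((p - 5 + 1).choose s : ℕ) *
    (p : ℚ) ^ (p - 5 + 1 - s - 2) * (((p - 5 : ℕ) : ℚ) + 1)⁻¹) ?_ ?_
  · exact mul_mem (mul_mem (mul_mem (bernoulli_mem (by omega)) (natCast_mem _ _))
      (pow_mem (natCast_mem _ _) _)) hinv
  · rw [show (p : ℚ) ^ (p - 5 + 1 - s) = (p : ℚ) ^ (p - 5 + 1 - s - 2) * (p : ℚ) ^ 2 by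
      rw [← pow_add]; congr 1; omega]
    rw [div_eq_mul_inv]
    ring

theorem invPowSum_sub_mem (hpn : p = 2 * n + 1) {s : ℕ} (hs : s ≤ p - 1) :
    invPowSum n s - ∑ l ∈ range n, ((l : ℚ) + 1) ^ (p - 1 - s) ∈ pIdeal p 1 :=
  sum_sub_sum_mem_pIdeal fun l hl =>
    invSucc_pow_sub_mem (by have := mem_range.1 hl; omega) hs

/-- The sum `σ` of the powers `k^{p-5}` is split by reflection and by parity; eliminating the half
sum `P` leaves `P'`, which is `S_5` modulo `p` by Fermat, in terms of `B_{p-5}`. -/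
theorem invPowSum_five_add_mem (hpn : p = 2 * n + 1) (h5 : 5 < p) :
    invPowSum n 5 + 6 * bernoulli (p - 5) ∈ pIdeal p 1 := by
  have hp6 : p ≠ 6 := by rintro rfl; exact absurd hp.out (by norm_num)
  obtain ⟨M, hM⟩ : ∃ M, p = M + 1 + 5 := ⟨p - 6, by omega⟩
  have hMe : Even (M + 1) := ⟨n - 2, by omega⟩
  set P := ∑ l ∈ range n, ((l : ℚ) + 1) ^ (M + 1) with hP
  set P' := ∑ l ∈ range n, ((l : ℚ) + 1) ^ M with hP'
  set b := bernoulli (p - 5) with hb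
  set σ := ∑ k ∈ range (p - 1), ((k : ℚ) + 1) ^ (M + 1) with hσ
  have hσb : σ - p * b ∈ pIdeal p 2 := by
    have := sum_pow_sub_five_sub_bernoulli_mem (p := p) h5
    rw [hb, hσ]
    rwa [show M + 1 = p - 5 by omega]
  have hP'm : P' ∈ pIntegral p :=
    sum_mem fun l _ => pow_mem (add_mem (natCast_mem _ _) (one_mem _)) _
  have hbm : b ∈ pIntegral p := bernoulli_mem (by omega)
  have binom : ∀ x : ℚ, x ∈ pIntegral p →
      ((p : ℚ) - x) ^ (M + 1) - (x ^ (M + 1) - (M + 1) * p * x ^ M) ∈ pIdeal p 2 := by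
    intro x hx
    obtain ⟨k, hk⟩ := Polynomial.powAddExpansion (⟨x, hx⟩ : pIntegral p) (-(p : pIntegral p)) (M + 1)
    have hk' := congrArg (Subtype.val) hk
    push_cast at hk'
    refine mem_pIdeal_of_eq k.2 ?_
    rw [← hMe.neg_pow, neg_sub, sub_eq_add_neg x, hk']
    ring
  have e1 : σ - (2 * P - (M + 1) * p * P') ∈ pIdeal p 2 := by
    have h := sum_range_two_mul_eq_sum_reflect (fun k => (k : ℚ) ^ (M + 1)) n
    push_cast at h
    rw [hσ, show p - 1 = 2 * n by omega, h, hP, hP', mul_sum, mul_sum, ← sum_sub_distrib]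
    refine sum_sub_sum_mem_pIdeal fun l hl => ?_
    have hl' := mem_range.1 hl
    convert binom ((l : ℚ) + 1) (add_mem (natCast_mem _ _) (one_mem _)) using 1
    rw [show ((2 * n - l : ℕ) : ℚ) = p - (l + 1) by
      rw [Nat.cast_sub (by omega), hpn]; push_cast; ring]
    ring
  have e2 : σ - (2 * 2 ^ (M + 1) * P - (M + 1) * p * 2 ^ M * P') ∈ pIdeal p 2 := by
    have h := sum_range_two_mul_eq_sum_parity (fun k => (k : ℚ) ^ (M + 1)) n
    push_cast at h
    rw [hσ, show p - 1 = 2 * n by omega, h, hP, hP', mul_sum, mul_sum, ← sum_sub_distrib]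
    refine sum_sub_sum_mem_pIdeal fun l hl => ?_
    have hl' := mem_range.1 hl
    convert binom (2 * ((l : ℚ) + 1))
      (mul_mem (ofNat_mem _ 2) (add_mem (natCast_mem _ _) (one_mem _))) using 1
    rw [show ((2 * n - 1 - 2 * l : ℕ) : ℚ) = p - 2 * (l + 1) by
      rw [Nat.sub_sub, Nat.cast_sub (by omega), hpn]; push_cast; ring]
    rw [mul_pow, mul_pow]
    ring
  have hH : invPowSum n 5 - P' ∈ pIdeal p 1 := by
    have := invPowSum_sub_mem (s := 5) hpn (by omega)
    rwa [show p - 1 - 5 = M by omega] at this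
  have hX : (2 ^ (M + 1) - 1) * b + (M + 1) * 2 ^ M * P' ∈ pIdeal p 1 := by
    have h2 : (2 : ℚ) ^ (M + 1) ∈ pIntegral p := pow_mem (ofNat_mem _ 2) _
    rw [← pow_mul_mem_pIdeal_iff (j := 1)]
    have := sub_mem (sub_mem (mul_mem_pIdeal h2 e1) e2)
      (mul_mem_pIdeal (sub_mem h2 (one_mem _)) hσb)
    convert this using 1
    ring
  have hT : (2 : ℚ) ^ (M + 5) - 1 ∈ pIdeal p 1 := by
    have := succ_pow_card_sub_one_sub_one_mem (p := p) (l := 1) (by omega)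
    rw [show p - 1 = M + 5 by omega] at this
    convert this using 2
    norm_num
  have hp1 : (p : ℚ) ^ 1 * P' ∈ pIdeal p 1 := ⟨_, hP'm, rfl⟩
  have hMm : (M : ℚ) + 1 ∈ pIntegral p := add_mem (natCast_mem _ _) (one_mem _)
  -- In `hX` multiplied by 32, `32 · 2^M = 2^{p-1} ≡ 1` and `M + 1 = p - 5 ≡ -5`, so it reads `-30 b
  -- - 5 P' ≡ 0`.
  refine mem_pIdeal_of_natCast_mul_mem (m := 5) (not_dvd_of_smooth h5 0 0 1) ?_
  have := add_mem (add_mem (add_mem (add_mem (mul_mem_pIdeal (ofNat_mem _ 5) hH)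
    (mul_mem_pIdeal (neg_mem (ofNat_mem _ 32)) hX))
    (mul_mem_pIdeal (mul_mem (ofNat_mem _ 2) hbm) hT))
    (mul_mem_pIdeal (mul_mem hMm hP'm) hT)) hp1
  convert this using 1
  rw [show (p : ℚ) = M + 1 + 5 by rw [hM]; push_cast; ring]
  push_cast
  ring

/-- By Fermat both inverse powers become positive powers, and the inner sum is a Faulhaber
polynomial; the double sum is then a combination of half power sums, nearly all divisible by `p`. -/
theorem invPowSum₂_add_mem (hpn : p = 2 * n + 1) (h5 : 5 < p) {a b : ℕ} (ha : 1 ≤ a) (hb : 1 ≤ b)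
    (hab : a + b = 5) :
    invPowSum₂ n a b + invPowSum n 5 / 2 +
      bernoulli (p - 5) * (p - a).choose (p - 5) / (p - a : ℕ) / 2 ∈ pIdeal p 1 := by
  have hp6 : p ≠ 6 := by rintro rfl; exact absurd hp.out (by norm_num)
  obtain ⟨M, hM⟩ : ∃ M, p = M + 1 + a := ⟨p - 1 - a, by omega⟩
  have hM0 : (M : ℚ) + 1 ≠ 0 := by positivity
  have hinv : ((M : ℚ) + 1)⁻¹ ∈ pIntegral p := by
    have := inv_natCast_mem_pIntegral (p := p) (m := M + 1)
      (Nat.not_dvd_of_pos_of_lt (by omega) (by omega))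
    push_cast at this
    exact this
  have e1 : invPowSum₂ n a b - ∑ i ∈ range n, ((i : ℚ) + 1) ^ (p - 1 - b) *
      ∑ j ∈ range i, ((j : ℚ) + 1) ^ M ∈ pIdeal p 1 := by
    refine sum_sub_sum_mem_pIdeal fun i hi => ?_
    have hi' := mem_range.1 hi
    refine mul_sub_mul_mem_pIdeal (invPowSum_mem (by omega) a)
      (pow_mem (add_mem (natCast_mem _ _) (one_mem _)) _)
      (invSucc_pow_sub_mem (by omega) (by omega)) (sum_sub_sum_mem_pIdeal fun j hj => ?_)
    have hj' := mem_range.1 hj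
    have := invSucc_pow_sub_mem (p := p) (l := j) (s := a) (by omega) (by omega)
    rwa [show p - 1 - a = M by omega] at this
  set c : ℕ → ℚ := fun s => bernoulli s * (M + 1).choose s * ((M : ℚ) + 1)⁻¹ with hc
  have hcm : ∀ s ≤ M, c s ∈ pIntegral p := fun s hs =>
    mul_mem (mul_mem (bernoulli_mem (by omega)) (natCast_mem _ _)) hinv
  have e2 : ∑ i ∈ range n, ((i : ℚ) + 1) ^ (p - 1 - b) * ∑ j ∈ range i, ((j : ℚ) + 1) ^ M =
      ∑ s ∈ range (M + 1), c s * ∑ i ∈ range n, ((i : ℚ) + 1) ^ (2 * p - 6 - s) := by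
    have h : ∀ i : ℕ, ∑ j ∈ range i, ((j : ℚ) + 1) ^ M =
        ∑ s ∈ range (M + 1), c s * ((i : ℚ) + 1) ^ (M + 1 - s) := by
      intro i
      have h := sum_range_pow (i + 1) M
      rw [sum_range_succ'] at h
      push_cast at h
      rw [zero_pow (by omega), add_zero] at h
      rw [h]
      refine sum_congr rfl fun s _ => ?_
      rw [hc]
      field_simp
    simp only [h, mul_sum]
    rw [sum_comm]
    refine sum_congr rfl fun s hs => sum_congr rfl fun i _ => ?_
    have hs' := mem_range.1 hs
    rw [show 2 * p - 6 - s = (p - 1 - b) + (M + 1 - s) by omega, pow_add]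
    ring
  -- Odd `s > 1` has `B_s = 0`. Even `s` gives an even exponent `2p-6-s`, divisible by `p - 1` only
  -- for `s = p - 5`, where the sum is `n ≡ -1/2`. For `s = 1` the coefficient is `-1/2` and the
  -- power sum is `S_5`.
  have e3 : ∑ s ∈ range (M + 1), c s * ∑ i ∈ range n, ((i : ℚ) + 1) ^ (2 * p - 6 - s) -
      ∑ s ∈ range (M + 1), ((if s = 1 then -(invPowSum n 5 / 2) else 0) +
        (if s = p - 5 then -(c s / 2) else 0)) ∈ pIdeal p 1 := by
    refine sum_sub_sum_mem_pIdeal fun s hs => ?_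
    have hs' := mem_range.1 hs
    by_cases h1 : s = 1
    · subst h1
      rw [if_pos rfl, if_neg (by omega)]
      have hc1 : c 1 = -1 / 2 := by
        simp only [hc, bernoulli_one, Nat.choose_one_right]
        push_cast
        field_simp
      have hH : invPowSum n 5 - ∑ i ∈ range n, ((i : ℚ) + 1) ^ (2 * p - 6 - 1) ∈ pIdeal p 1 := by
        have h := invPowSum_sub_mem (s := 5) hpn (by omega)
        have h2 : ∑ i ∈ range n, ((i : ℚ) + 1) ^ (2 * p - 6 - 1) -
            ∑ i ∈ range n, ((i : ℚ) + 1) ^ (p - 1 - 5) ∈ pIdeal p 1 := by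
          refine sum_sub_sum_mem_pIdeal fun i hi => ?_
          have hi' := mem_range.1 hi
          have := mul_mem_pIdeal
            (pow_mem (add_mem (natCast_mem (pIntegral p) i) (one_mem _)) (p - 1 - 5))
            (succ_pow_card_sub_one_sub_one_mem (p := p) (l := i) (by omega))
          convert this using 1
          rw [mul_sub, mul_one, ← pow_add]
          congr 2
          omega
        convert sub_mem h h2 using 1
        ring
      convert mul_mem_pIdeal (inv_two_mem h5) hH using 1
      rw [hc1]
      ring
    · rw [if_neg h1, zero_add]
      by_cases h2 : s = p - 5
      · rw [if_pos h2]
        have hn : ∑ i ∈ range n, ((i : ℚ) + 1) ^ (2 * p - 6 - s) - n ∈ pIdeal p 1 := by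
          have : (n : ℚ) = ∑ i ∈ range n, 1 := by simp
          rw [this]
          refine sum_sub_sum_mem_pIdeal fun i hi => ?_
          have hi' := mem_range.1 hi
          rw [show 2 * p - 6 - s = p - 1 by omega]
          exact succ_pow_card_sub_one_sub_one_mem (by omega)
        have h3 := mul_mem_pIdeal (hcm s (by omega)) hn
        have h4 : (p : ℚ) ^ 1 * (c s * 2⁻¹) ∈ pIdeal p 1 :=
          ⟨_, mul_mem (hcm s (by omega)) (inv_two_mem h5), rfl⟩
        convert add_mem h3 h4 using 1
        rw [hpn]
        push_cast
        ring
      · rw [if_neg h2, sub_zero]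
        rcases Nat.even_or_odd s with hse | hso
        · refine mul_mem_pIdeal (hcm s (by omega)) (sum_pow_half_mem_pIdeal hpn h5 ?_ ?_)
          · rintro ⟨k, hk⟩
            rcases k with _ | _ | k
            · omega
            · omega
            · have : (p - 1) * 2 ≤ (p - 1) * (k + 1 + 1) := Nat.mul_le_mul_left _ (by omega)
              omega
          · obtain ⟨r, hr⟩ := hse
            exact ⟨p - 3 - r, by omega⟩
        · rw [show c s = 0 by
            simp [hc, bernoulli_eq_zero_of_odd hso (by obtain ⟨r, hr⟩ := hso; omega)], zero_mul]
          exact zero_mem _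
  rw [sum_add_distrib, sum_ite_eq', sum_ite_eq', if_pos (mem_range.2 (by omega)),
    if_pos (mem_range.2 (by omega)), ← e2] at e3
  convert add_mem e1 e3 using 1
  rw [show p - a = M + 1 by omega, hc]
  push_cast
  field_simp
  ring

end

/-! ### Inverse power sums and double sums in terms of `H_{p-1}/p` and `B_{p-5}` -/

/-- The hypothesis says `v = -u/(1 - P u)`. It is met by `u = 1/k`, `v = 1/(p-k)` and by `u =
1/(2k)`, `v = 1/(p-2k)`, with `P = p`. -/
theorem geom_expansion {P u v : ℚ} (h : v = -u + P * u * v) :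
    v = -(u + P * u ^ 2 + P ^ 2 * u ^ 3 + P ^ 3 * u ^ 4) + P ^ 4 * (u ^ 4 * v) := by
  linear_combination (1 + P * u + P ^ 2 * u ^ 2 + P ^ 3 * u ^ 3) * h

theorem geom_mul_self {P u v : ℚ} (h : v = -u + P * u * v) : v * (1 - P * u) = -u := by
  linear_combination h

section

variable {n : ℕ}

theorem cast_two_mul_sub {p l : ℕ} (hpn : p = 2 * n + 1) (hl : l < n) :
    ((2 * n - l : ℕ) : ℚ)⁻¹ = invSub p l := by
  rw [invSub, Nat.cast_sub (by omega), hpn]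
  push_cast
  congr 1
  ring

theorem cast_two_mul_sub_one_sub {p l : ℕ} (hpn : p = 2 * n + 1) (hl : l < n) :
    ((2 * n - 1 - 2 * l : ℕ) : ℚ)⁻¹ = invSubTwo p l := by
  rw [invSubTwo, Nat.sub_sub, Nat.cast_sub (by omega), hpn]
  push_cast
  congr 1
  ring

theorem sum_signed_inv_pow_eq_reflect {p : ℕ} (hpn : p = 2 * n + 1) (s : ℕ) :
    ∑ k ∈ range (p - 1), (-1 : ℚ) ^ (k + 1) * (((k + 1 : ℕ) : ℚ))⁻¹ ^ s =
      ∑ l ∈ range n, (-1) ^ (l + 1) * (invSucc l ^ s - invSub p l ^ s) := by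
  have h := sum_range_two_mul_eq_sum_reflect (fun k => (-1 : ℚ) ^ k * ((k : ℚ))⁻¹ ^ s) n
  rw [show p - 1 = 2 * n by omega, h]
  refine sum_congr rfl fun l hl => ?_
  have hl' := mem_range.1 hl
  rw [cast_two_mul_sub hpn hl']
  have e : (-1 : ℚ) ^ (2 * n - l) = (-1) ^ l := by
    rw [← mul_left_inj' (pow_ne_zero l (by norm_num : (-1 : ℚ) ≠ 0)), ← pow_add, ← pow_add,
      Nat.sub_add_cancel (by omega), ← two_mul, pow_mul, pow_mul]
    simp
  simp only [e, invSucc]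
  push_cast
  ring

theorem sum_signed_inv_pow_eq_parity {p : ℕ} (hpn : p = 2 * n + 1) (s : ℕ) :
    ∑ k ∈ range (p - 1), (-1 : ℚ) ^ (k + 1) * (((k + 1 : ℕ) : ℚ))⁻¹ ^ s =
      ∑ l ∈ range n, ((invSucc l / 2) ^ s - invSubTwo p l ^ s) := by
  have h := sum_range_two_mul_eq_sum_parity (fun k => (-1 : ℚ) ^ k * ((k : ℚ))⁻¹ ^ s) n
  rw [show p - 1 = 2 * n by omega, h]
  refine sum_congr rfl fun l hl => ?_
  have hl' := mem_range.1 hl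
  have e : (-1 : ℚ) ^ (2 * n - 1 - 2 * l) = -1 := Odd.neg_one_pow ⟨n - 1 - l, by omega⟩
  have e2 : (-1 : ℚ) ^ (2 * (l + 1)) = 1 := by rw [pow_mul]; simp
  rw [cast_two_mul_sub_one_sub hpn hl', e, e2, invSucc]
  push_cast
  rw [mul_inv, div_eq_mul_inv]
  ring

theorem sum_inv_pow_eq_reflect {p : ℕ} (hpn : p = 2 * n + 1) (s : ℕ) :
    ∑ k ∈ range (p - 1), (((k + 1 : ℕ) : ℚ))⁻¹ ^ s =
      ∑ l ∈ range n, (invSucc l ^ s + invSub p l ^ s) := by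
  have h := sum_range_two_mul_eq_sum_reflect (fun k => ((k : ℚ))⁻¹ ^ s) n
  rw [show p - 1 = 2 * n by omega, h]
  refine sum_congr rfl fun l hl => ?_
  rw [cast_two_mul_sub hpn (mem_range.1 hl), invSucc]
  push_cast
  rfl

theorem sum_inv_pow_eq_parity {p : ℕ} (hpn : p = 2 * n + 1) (s : ℕ) :
    ∑ k ∈ range (p - 1), (((k + 1 : ℕ) : ℚ))⁻¹ ^ s =
      ∑ l ∈ range n, ((invSucc l / 2) ^ s + invSubTwo p l ^ s) := by
  have h := sum_range_two_mul_eq_sum_parity (fun k => ((k : ℚ))⁻¹ ^ s) n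
  rw [show p - 1 = 2 * n by omega, h]
  refine sum_congr rfl fun l hl => ?_
  rw [cast_two_mul_sub_one_sub hpn (mem_range.1 hl), invSucc]
  push_cast
  rw [mul_inv, div_eq_mul_inv]
  ring

/-- The harmonic number `H_{p-1}` divided by `p`. -/
def harmonicQuot (p : ℕ) : ℚ := harmonic (p - 1) / p

variable {p : ℕ} [hp : Fact p.Prime]

theorem cast_prime_ne_zero : (p : ℚ) ≠ 0 := Nat.cast_ne_zero.2 hp.out.ne_zero

theorem harmonicQuot_eq_reflect (hpn : p = 2 * n + 1) :
    harmonicQuot p = ∑ l ∈ range n, invSucc l * invSub p l := by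
  have h := sum_inv_pow_eq_reflect hpn 1
  simp only [pow_one] at h
  rw [harmonicQuot, harmonic, h, div_eq_iff cast_prime_ne_zero, sum_mul]
  refine sum_congr rfl fun l hl => ?_
  linear_combination invSub_eq (p := p) (l := l) (by have := mem_range.1 hl; omega)

theorem harmonicQuot_eq_parity (hpn : p = 2 * n + 1) :
    harmonicQuot p = ∑ l ∈ range n, invSucc l / 2 * invSubTwo p l := by
  have h := sum_inv_pow_eq_parity hpn 1
  simp only [pow_one] at h
  rw [harmonicQuot, harmonic, h, div_eq_iff cast_prime_ne_zero, sum_mul]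
  refine sum_congr rfl fun l hl => ?_
  linear_combination invSubTwo_eq (p := p) (l := l) (by have := mem_range.1 hl; omega)

theorem harmonicQuot_add_mem (hpn : p = 2 * n + 1) :
    harmonicQuot p + invPowSum n 2 + p * invPowSum n 3 + p ^ 2 * invPowSum n 4 +
      p ^ 3 * invPowSum n 5 ∈ pIdeal p 4 := by
  rw [harmonicQuot_eq_reflect hpn]
  simp only [invPowSum, mul_sum, ← sum_add_distrib]
  refine sum_mem fun l hl => ?_
  have hl' := mem_range.1 hl
  refine mem_pIdeal_of_eq (mul_mem (pow_mem (invSucc_mem (p := p) (l := l) (by omega)) 5)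
    (invSub_mem (p := p) (l := l) (by omega))) ?_
  linear_combination invSucc l * geom_expansion (invSub_eq (p := p) (l := l) (by omega))

theorem four_mul_harmonicQuot_add_mem (hpn : p = 2 * n + 1) (h5 : 5 < p) :
    4 * harmonicQuot p + invPowSum n 2 + p * invPowSum n 3 / 2 + p ^ 2 * invPowSum n 4 / 4 +
      p ^ 3 * invPowSum n 5 / 8 ∈ pIdeal p 4 := by
  rw [harmonicQuot_eq_parity hpn]
  simp only [invPowSum, mul_sum, sum_div, ← sum_add_distrib]
  refine sum_mem fun l hl => ?_
  have hl' := mem_range.1 hl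
  refine mem_pIdeal_of_eq (mul_mem (ofNat_mem _ 4)
    (mul_mem (pow_mem (half_invSucc_mem (p := p) (l := l) h5 (by omega)) 5)
    (invSubTwo_mem (p := p) (l := l) (by omega)))) ?_
  linear_combination 2 * invSucc l * geom_expansion (invSubTwo_eq (p := p) (l := l) (by omega))

theorem geom_pow_four_mem {u v : ℚ} (hu : u ∈ pIntegral p) (hv : v ∈ pIntegral p)
    (h : v = -u + p * u * v) : v ^ 4 - (u ^ 4 + 4 * p * u ^ 5) ∈ pIdeal p 2 := by
  have h1 := geom_mul_self h
  set z := (p : ℚ) * u with hz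
  -- The cubic is `(1 - (1+4z)(1-z)^4) / z²`.
  refine mem_pIdeal_of_eq (c := v ^ 4 * u ^ 2 * (10 - 20 * z + 15 * z ^ 2 - 4 * z ^ 3)) ?_ ?_
  · have hzm : z ∈ pIntegral p := mul_mem (natCast_mem _ _) hu
    exact mul_mem (mul_mem (pow_mem hv 4) (pow_mem hu 2))
      (sub_mem (add_mem (sub_mem (ofNat_mem _ 10) (mul_mem (ofNat_mem _ 20) hzm))
        (mul_mem (ofNat_mem _ 15) (pow_mem hzm 2))) (mul_mem (ofNat_mem _ 4) (pow_mem hzm 3)))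
  · have e : u ^ 4 = (v * (1 - z)) ^ 4 := by rw [h1]; ring
    rw [show u ^ 4 + 4 * p * u ^ 5 = u ^ 4 * (1 + 4 * z) by rw [hz]; ring, e, hz]
    ring

/-- The sum of `1/k^4` over `1 ≤ k ≤ p-1` is evaluated by reflection and by parity. -/
theorem fifteen_mul_invPowSum_four_add_mem (hpn : p = 2 * n + 1) (h5 : 5 < p) :
    15 * invPowSum n 4 + 31 * (p * invPowSum n 5) ∈ pIdeal p 2 := by
  have e := (sum_inv_pow_eq_reflect hpn 4).symm.trans (sum_inv_pow_eq_parity hpn 4)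
  have h1 : ∑ l ∈ range n, (invSucc l ^ 4 + invSub p l ^ 4) -
      ∑ l ∈ range n, (2 * invSucc l ^ 4 + 4 * p * invSucc l ^ 5) ∈ pIdeal p 2 := by
    refine sum_sub_sum_mem_pIdeal fun l hl => ?_
    have hl' := mem_range.1 hl
    convert geom_pow_four_mem (p := p) (invSucc_mem (l := l) (by omega)) (invSub_mem (by omega))
      (invSub_eq (by omega)) using 1
    ring
  have h2 : ∑ l ∈ range n, ((invSucc l / 2) ^ 4 + invSubTwo p l ^ 4) -
      ∑ l ∈ range n, (2 * (invSucc l / 2) ^ 4 + 4 * p * (invSucc l / 2) ^ 5) ∈ pIdeal p 2 := by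
    refine sum_sub_sum_mem_pIdeal fun l hl => ?_
    have hl' := mem_range.1 hl
    convert geom_pow_four_mem (p := p) (half_invSucc_mem (l := l) h5 (by omega))
      (invSubTwo_mem (by omega)) (invSubTwo_eq (by omega)) using 1
    ring
  convert mul_mem_pIdeal (ofNat_mem _ 8) (sub_mem h2 h1) using 1
  rw [e]
  simp only [invPowSum, mul_sum, sub_sub_sub_cancel_left, ← sum_add_distrib, ← sum_sub_distrib]
  exact sum_congr rfl fun l _ => by ring

theorem invPowSum_four_mem (hpn : p = 2 * n + 1) (h5 : 5 < p) :
    5 * invPowSum n 4 - 62 * (p * bernoulli (p - 5)) ∈ pIdeal p 2 := by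
  refine mem_pIdeal_of_natCast_mul_mem (m := 3) (not_dvd_of_smooth h5 0 1 0) ?_
  have h1 := fifteen_mul_invPowSum_four_add_mem hpn h5
  have h2 := pow_mul_mem_pIdeal 1 (invPowSum_five_add_mem hpn h5)
  convert sub_mem h1 (mul_mem_pIdeal (ofNat_mem _ 31) h2) using 1
  push_cast
  ring

/-- The difference of the two expansions of `H_{p-1}/p` eliminates `S_2`. -/
theorem invPowSum_three_mem (hpn : p = 2 * n + 1) (h5 : 5 < p) :
    60 * harmonicQuot p - 10 * (p * invPowSum n 3) - 81 * (p ^ 3 * bernoulli (p - 5)) ∈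
      pIdeal p 4 := by
  refine mem_pIdeal_of_natCast_mul_mem (m := 2) (not_dvd_of_smooth h5 1 0 0) ?_
  have h1 := harmonicQuot_add_mem hpn
  have h2 := four_mul_harmonicQuot_add_mem hpn h5
  have h3 := pow_mul_mem_pIdeal 2 (invPowSum_four_mem hpn h5)
  have h4 := pow_mul_mem_pIdeal 3 (invPowSum_five_add_mem hpn h5)
  convert add_mem (add_mem (mul_mem_pIdeal (ofNat_mem _ 40) (sub_mem h2 h1))
    (mul_mem_pIdeal (ofNat_mem _ 6) h3)) (mul_mem_pIdeal (ofNat_mem _ 35) h4) using 1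
  push_cast
  ring

theorem invPowSum_two_mem (hpn : p = 2 * n + 1) (h5 : 5 < p) :
    10 * invPowSum n 2 + 70 * harmonicQuot p - 17 * (p ^ 3 * bernoulli (p - 5)) ∈ pIdeal p 4 := by
  have h1 := harmonicQuot_add_mem hpn
  have h2 := invPowSum_three_mem hpn h5
  have h3 := pow_mul_mem_pIdeal 2 (invPowSum_four_mem hpn h5)
  have h4 := pow_mul_mem_pIdeal 3 (invPowSum_five_add_mem hpn h5)
  convert sub_mem (sub_mem (add_mem (mul_mem_pIdeal (ofNat_mem _ 10) h1) h2)
    (mul_mem_pIdeal (ofNat_mem _ 2) h3)) (mul_mem_pIdeal (ofNat_mem _ 10) h4) using 1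
  ring

/-- Wolstenholme's theorem `H_{p-1} ≡ 0 (mod p²)`. -/
theorem harmonicQuot_mem (hpn : p = 2 * n + 1) (h5 : 5 < p) : harmonicQuot p ∈ pIdeal p 1 := by
  refine mem_pIdeal_of_natCast_mul_mem (m := 60) (by
    simpa using not_dvd_of_smooth h5 2 1 1) ?_
  have hn : n < p := by omega
  have h := pIdeal_mono (by norm_num : 1 ≤ 4) (invPowSum_three_mem hpn h5)
  have h1 : (p : ℚ) ^ 1 * (10 * invPowSum n 3 + 81 * (p ^ 2 * bernoulli (p - 5))) ∈ pIdeal p 1 :=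
    ⟨_, add_mem (mul_mem (ofNat_mem _ 10) (invPowSum_mem hn 3)) (mul_mem (ofNat_mem _ 81)
      (mul_mem (pow_mem (natCast_mem _ _) 2) (bernoulli_mem (by omega)))), rfl⟩
  convert add_mem h h1 using 1
  push_cast
  ring

theorem invPowSum_two_mem_pIdeal (hpn : p = 2 * n + 1) (h5 : 5 < p) :
    invPowSum n 2 ∈ pIdeal p 1 := by
  have hn : n < p := by omega
  have h := pIdeal_mono (by norm_num : 1 ≤ 4) (harmonicQuot_add_mem hpn)
  have h1 : (p : ℚ) ^ 1 * (invPowSum n 3 + p * invPowSum n 4 + p ^ 2 * invPowSum n 5) ∈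
      pIdeal p 1 :=
    ⟨_, add_mem (add_mem (invPowSum_mem hn 3) (mul_mem (natCast_mem _ _) (invPowSum_mem hn 4)))
      (mul_mem (pow_mem (natCast_mem _ _) 2) (invPowSum_mem hn 5)), rfl⟩
  convert sub_mem (sub_mem h h1) (harmonicQuot_mem hpn h5) using 1
  ring

theorem invPowSum₂_two_two (n : ℕ) :
    2 * invPowSum₂ n 2 2 = invPowSum n 2 ^ 2 - invPowSum n 4 := by
  induction n with
  | zero => simp [invPowSum₂, invPowSum]
  | succ n ih =>
    have e1 : invPowSum₂ (n + 1) 2 2 = invPowSum₂ n 2 2 + invSucc n ^ 2 * invPowSum n 2 :=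
      sum_range_succ _ _
    have e2 : ∀ s, invPowSum (n + 1) s = invPowSum n s + invSucc n ^ s :=
      fun s => sum_range_succ _ _
    rw [e1, e2, e2]
    linear_combination ih

theorem invPowSum₂_two_two_mem (hpn : p = 2 * n + 1) (h5 : 5 < p) :
    5 * invPowSum₂ n 2 2 + 31 * (p * bernoulli (p - 5)) ∈ pIdeal p 2 := by
  refine mem_pIdeal_of_natCast_mul_mem (m := 2) (not_dvd_of_smooth h5 1 0 0) ?_
  have h1 := invPowSum_four_mem hpn h5
  have h2 := mul_mem_pIdeal_add (invPowSum_two_mem_pIdeal hpn h5) (invPowSum_two_mem_pIdeal hpn h5)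
  convert sub_mem (mul_mem_pIdeal (ofNat_mem _ 5) h2) h1 using 1
  push_cast
  linear_combination 5 * invPowSum₂_two_two n

theorem invPowSum₂_two_three_mem (hpn : p = 2 * n + 1) (h5 : 5 < p) :
    invPowSum₂ n 2 3 - 2 * bernoulli (p - 5) ∈ pIdeal p 1 := by
  have hbm : bernoulli (p - 5) ∈ pIntegral p := bernoulli_mem (by omega)
  refine mem_pIdeal_of_natCast_mul_mem (m := 12) (by simpa using not_dvd_of_smooth h5 2 1 0) ?_
  have h1 := invPowSum₂_add_mem (a := 2) (b := 3) hpn h5 (by norm_num) (by norm_num) rfl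
  have h2 := invPowSum_five_add_mem hpn h5
  obtain ⟨q, hq⟩ : ∃ q, p = q + 5 := ⟨p - 5, by omega⟩
  have hc : (((p - 2).choose (p - 5) : ℕ) : ℚ) = (q + 3) * (q + 2) * (q + 1) / 6 := by
    have := Nat.descFactorial_eq_factorial_mul_choose (q + 3) 3
    rw [show p - 2 = q + 3 by omega, show p - 5 = q by omega, Nat.choose_symm_add,
      eq_div_iff (by norm_num)]
    simp only [Nat.descFactorial, Nat.factorial, show q + 3 - 2 = q + 1 by omega] at this
    norm_num at this
    qify at this
    linear_combination -this
  -- The binomial quotient is `(p-3)(p-4)/6`, and `(p-3)(p-4) = 12 - p(7-p)`.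
  have h3 : (p : ℚ) ^ 1 * (bernoulli (p - 5) * (7 - p)) ∈ pIdeal p 1 :=
    ⟨_, mul_mem hbm (sub_mem (ofNat_mem _ 7) (natCast_mem _ _)), rfl⟩
  convert add_mem (sub_mem (mul_mem_pIdeal (ofNat_mem _ 12) h1)
    (mul_mem_pIdeal (ofNat_mem _ 6) h2)) h3 using 1
  have h0 : (q : ℚ) + 3 ≠ 0 := by positivity
  rw [hc, show ((p - 2 : ℕ) : ℚ) = q + 3 by rw [show p - 2 = q + 3 by omega]; push_cast; rfl]
  rw [show (p : ℚ) = q + 5 by rw [hq]; push_cast; rfl]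
  push_cast
  field_simp
  ring

theorem invPowSum₂_three_two_mem (hpn : p = 2 * n + 1) (h5 : 5 < p) :
    invPowSum₂ n 3 2 - 4 * bernoulli (p - 5) ∈ pIdeal p 1 := by
  have hbm : bernoulli (p - 5) ∈ pIntegral p := bernoulli_mem (by omega)
  refine mem_pIdeal_of_natCast_mul_mem (m := 4) (by simpa using not_dvd_of_smooth h5 2 0 0) ?_
  have h1 := invPowSum₂_add_mem (a := 3) (b := 2) hpn h5 (by norm_num) (by norm_num) rfl
  have h2 := invPowSum_five_add_mem hpn h5
  obtain ⟨q, hq⟩ : ∃ q, p = q + 5 := ⟨p - 5, by omega⟩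
  have hc : (((p - 3).choose (p - 5) : ℕ) : ℚ) = (q + 2) * (q + 1) / 2 := by
    have := Nat.descFactorial_eq_factorial_mul_choose (q + 2) 2
    rw [show p - 3 = q + 2 by omega, show p - 5 = q by omega, Nat.choose_symm_add,
      eq_div_iff (by norm_num)]
    simp only [Nat.descFactorial, Nat.factorial] at this
    norm_num at this
    qify at this
    linear_combination -this
  have h3 : (p : ℚ) ^ 1 * bernoulli (p - 5) ∈ pIdeal p 1 := ⟨_, hbm, rfl⟩
  convert sub_mem (sub_mem (mul_mem_pIdeal (ofNat_mem _ 4) h1)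
    (mul_mem_pIdeal (ofNat_mem _ 2) h2)) h3 using 1
  have h0 : (q : ℚ) + 2 ≠ 0 := by positivity
  rw [hc, show ((p - 3 : ℕ) : ℚ) = q + 2 by rw [show p - 3 = q + 2 by omega]; push_cast; rfl]
  rw [show (p : ℚ) = q + 5 by rw [hq]; push_cast; rfl]
  push_cast
  field_simp
  ring

theorem invPowSum₂_four_one_mem (hpn : p = 2 * n + 1) (h5 : 5 < p) :
    2 * invPowSum₂ n 4 1 - 5 * bernoulli (p - 5) ∈ pIdeal p 1 := by
  have h1 := invPowSum₂_add_mem (a := 4) (b := 1) hpn h5 (by norm_num) (by norm_num) rfl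
  have h2 := invPowSum_five_add_mem hpn h5
  obtain ⟨q, hq⟩ : ∃ q, p = q + 5 := ⟨p - 5, by omega⟩
  convert sub_mem (mul_mem_pIdeal (ofNat_mem _ 2) h1) h2 using 1
  have h0 : (q : ℚ) + 1 ≠ 0 := by positivity
  rw [show (p - 4).choose (p - 5) = q + 1 by
      rw [show p - 4 = q + 1 by omega, show p - 5 = q by omega, Nat.choose_succ_self_right],
    show p - 4 = q + 1 by omega]
  push_cast
  field_simp
  ring

end

/-! ### The remainder terms -/

/-- The product of `1 - p² / (p - 2 j)²` over `1 ≤ j ≤ i`. -/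
def revProd (p i : ℕ) : ℚ := ∏ j ∈ range i, (1 - (p : ℚ) ^ 2 * invSubTwo p j ^ 2)

theorem oddProd_sub {p n : ℕ} (hpn : p = 2 * n + 1) {i : ℕ} (hi : i ≤ n) :
    oddProd p (n - i) = oddProd p n * revProd p i := by
  induction i with
  | zero => simp [revProd]
  | succ i ih =>
    have e : n - i = n - (i + 1) + 1 := by omega
    have hcast : 2 * ((n - (i + 1) : ℕ) : ℚ) + 1 = p - 2 * (i + 1) := by
      rw [Nat.cast_sub hi, hpn]; push_cast; ring
    have hin : (i : ℚ) + 1 ≤ n := by exact_mod_cast hi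
    have hi0 : (0 : ℚ) ≤ i := i.cast_nonneg
    have hpq : (p : ℚ) = 2 * n + 1 := by rw [hpn]; push_cast; rfl
    have hne : 1 - (p : ℚ) ^ 2 * invSubTwo p i ^ 2 ≠ 0 := by
      have h0 : (p : ℚ) - 2 * (i + 1) ≠ 0 := by linarith
      rw [invSubTwo, inv_pow, ← div_eq_mul_inv, sub_ne_zero, ne_comm, Ne,
        div_eq_one_iff_eq (pow_ne_zero 2 h0)]
      nlinarith
    rw [revProd, prod_range_succ, ← revProd, ← mul_assoc, ← ih (by omega), e, oddProd_succ, hcast]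
    rw [show (p : ℚ) ^ 2 / (p - 2 * (i + 1)) ^ 2 = (p : ℚ) ^ 2 * invSubTwo p i ^ 2 by
      rw [invSubTwo, inv_pow, div_eq_mul_inv], inv_mul_cancel_right₀ hne]

theorem cast_two_mul_sub_add_one {p n : ℕ} (hpn : p = 2 * n + 1) {i : ℕ} (hi : i < n) :
    (2 * ((n - 1 - i : ℕ) : ℚ) + 1)⁻¹ = invSubTwo p i := by
  rw [invSubTwo, Nat.sub_sub, Nat.cast_sub (by omega), hpn]
  push_cast
  congr 1
  ring

theorem oddProd_mul_revProd {p n : ℕ} (hpn : p = 2 * n + 1) : oddProd p n * revProd p n = 1 := by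
  rw [← oddProd_sub hpn le_rfl, Nat.sub_self, oddProd_zero]

/-- Reversal turns the denominator `p - (2k+1)` into `2(i+1)`, which is prime to `p`, and the
product into one whose factors are 1 modulo `p²`. -/
theorem oddTerm_sub {p n : ℕ} (hpn : p = 2 * n + 1) {i : ℕ} (hi : i < n) :
    oddTerm p (n - 1 - i) = oddProd p n * (invSucc i * revProd p (i + 1)) / 4 := by
  rw [oddTerm, show n - 1 - i = n - (i + 1) by omega, oddProd_sub hpn hi, Nat.cast_sub hi, hpn,
    invSucc]
  push_cast
  rw [show 2 * (2 * (n : ℚ) + 1 - (2 * (n - (i + 1)) + 1)) = 4 * (i + 1) by ring]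
  have : (i : ℚ) + 1 ≠ 0 := by positivity
  field_simp

theorem sum_oddTerm {p n : ℕ} (hpn : p = 2 * n + 1) :
    ∑ k ∈ range n, oddTerm (2 * n + 1) k =
      oddProd p n * (∑ i ∈ range n, invSucc i * revProd p (i + 1)) / 4 := by
  rw [← sum_range_reflect, mul_sum, sum_div]
  refine sum_congr rfl fun i hi => ?_
  rw [← oddTerm_sub hpn (mem_range.1 hi), hpn]
  push_cast
  rfl

theorem sum_oddTerm_div {p n : ℕ} (hpn : p = 2 * n + 1) :
    ∑ k ∈ range n, oddTerm (2 * n + 1) k / (2 * k + 1) =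
      oddProd p n * (∑ i ∈ range n, invSucc i * invSubTwo p i * revProd p (i + 1)) / 4 := by
  rw [← sum_range_reflect, mul_sum, sum_div]
  refine sum_congr rfl fun i hi => ?_
  rw [div_eq_mul_inv, cast_two_mul_sub_add_one hpn (mem_range.1 hi),
    show (2 * (n : ℚ) + 1) = p by rw [hpn]; push_cast; rfl, oddTerm_sub hpn (mem_range.1 hi)]
  ring

theorem sum_one_div_odd_sq {p n : ℕ} (hpn : p = 2 * n + 1) :
    ∑ k ∈ range n, 1 / (2 * (k : ℚ) + 1) ^ 2 = ∑ i ∈ range n, invSubTwo p i ^ 2 := by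
  rw [← sum_range_reflect]
  refine sum_congr rfl fun i hi => ?_
  rw [← cast_two_mul_sub_add_one hpn (mem_range.1 hi), inv_pow, one_div]

theorem sum_neg_one_pow_div_odd {p n : ℕ} (hpn : p = 2 * n + 1) :
    (-1) ^ n * ∑ k ∈ range n, (-1) ^ k / (2 * (k : ℚ) + 1) =
      ∑ i ∈ range n, (-1) ^ (i + 1) * invSubTwo p i := by
  rw [← sum_range_reflect, mul_sum]
  refine sum_congr rfl fun i hi => ?_
  have hi' := mem_range.1 hi
  rw [← cast_two_mul_sub_add_one hpn hi', div_eq_mul_inv, ← mul_assoc, ← pow_add,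
    show n + (n - 1 - i) = 2 * (n - 1 - i) + (i + 1) by omega, pow_add, pow_mul]
  simp

section

variable {p n : ℕ} [hp : Fact p.Prime]

/-! ### Expansions of the terms -/

theorem geom_pow_two_mem {u v : ℚ} (hu : u ∈ pIntegral p) (hv : v ∈ pIntegral p)
    (h : v = -u + p * u * v) :
    v ^ 2 - (u ^ 2 + 2 * p * u ^ 3 + 3 * p ^ 2 * u ^ 4 + 4 * p ^ 3 * u ^ 5) ∈ pIdeal p 4 := by
  have h1 := geom_mul_self h
  refine mem_pIdeal_of_eq (c := v ^ 2 * u ^ 4 * (5 - 4 * (p * u)))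
    (mul_mem (mul_mem (pow_mem hv 2) (pow_mem hu 4))
      (sub_mem (ofNat_mem _ 5) (mul_mem (ofNat_mem _ 4) (mul_mem (natCast_mem _ _) hu)))) ?_
  have e : u ^ 2 = (v * (1 - p * u)) ^ 2 := by rw [h1]; ring
  rw [show u ^ 2 + 2 * p * u ^ 3 + 3 * p ^ 2 * u ^ 4 + 4 * p ^ 3 * u ^ 5 =
    u ^ 2 * (1 + 2 * (p * u) + 3 * (p * u) ^ 2 + 4 * (p * u) ^ 3) by ring, e]
  ring

theorem geom_pow_three_mem {u v : ℚ} (hu : u ∈ pIntegral p) (hv : v ∈ pIntegral p)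
    (h : v = -u + p * u * v) :
    v ^ 3 + (u ^ 3 + 3 * p * u ^ 4 + 6 * p ^ 2 * u ^ 5) ∈ pIdeal p 3 := by
  have h1 := geom_mul_self h
  have hz : (p : ℚ) * u ∈ pIntegral p := mul_mem (natCast_mem _ _) hu
  refine mem_pIdeal_of_eq (c := v ^ 3 * u ^ 3 * (10 - 15 * (p * u) + 6 * (p * u) ^ 2))
    (mul_mem (mul_mem (pow_mem hv 3) (pow_mem hu 3))
      (add_mem (sub_mem (ofNat_mem _ 10) (mul_mem (ofNat_mem _ 15) hz))
        (mul_mem (ofNat_mem _ 6) (pow_mem hz 2)))) ?_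
  have e : u ^ 3 = -(v * (1 - p * u)) ^ 3 := by rw [h1]; ring
  linear_combination (1 + 3 * (p * u) + 6 * (p * u) ^ 2) * e

theorem pow_sub_pow_mem {k : ℕ} {x y : ℚ} (hx : x ∈ pIntegral p) (hy : y ∈ pIntegral p)
    (h : x - y ∈ pIdeal p k) (s : ℕ) : x ^ s - y ^ s ∈ pIdeal p k := by
  induction s with
  | zero => simp
  | succ s ih =>
    rw [pow_succ, pow_succ]
    exact mul_sub_mul_mem_pIdeal hx (pow_mem hy s) ih h

/-- Elementary symmetric functions of degree at least 3 carry `p^6`. -/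
theorem prod_one_sub_sub_mem {f : ℕ → ℚ} {i : ℕ} (hf : ∀ j < i, f j ∈ pIntegral p) :
    ∏ j ∈ range i, (1 - p ^ 2 * f j) -
      (1 - p ^ 2 * ∑ j ∈ range i, f j + p ^ 4 * ∑ j ∈ range i, f j * ∑ k ∈ range j, f k) ∈
        pIdeal p 6 := by
  induction i with
  | zero => simp
  | succ i ih =>
    have hfi := hf i i.lt_succ_self
    have hsum : ∑ j ∈ range i, f j * ∑ k ∈ range j, f k ∈ pIntegral p :=
      sum_mem fun j hj => by
        have hj' := mem_range.1 hj
        exact mul_mem (hf j (by omega)) (sum_mem fun k hk => hf k (by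
          have := mem_range.1 hk; omega))
    have h1 : 1 - (p : ℚ) ^ 2 * f i ∈ pIntegral p :=
      sub_mem (one_mem _) (mul_mem (pow_mem (natCast_mem _ _) 2) hfi)
    have h2 := mul_mem_pIdeal h1 (ih fun j hj => hf j (by omega))
    have h3 : (p : ℚ) ^ 6 * (f i * ∑ j ∈ range i, f j * ∑ k ∈ range j, f k) ∈ pIdeal p 6 :=
      ⟨_, mul_mem hfi hsum, rfl⟩
    rw [prod_range_succ, sum_range_succ, sum_range_succ]
    convert sub_mem h2 h3 using 1
    ring

theorem oddProd_mem (hpn : p = 2 * n + 1) (h5 : 5 < p) : oddProd p n ∈ pIntegral p := by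
  rw [show (p : ℚ) = 2 * n + 1 by rw [hpn]; push_cast; rfl, oddProd_eq_choose, div_eq_mul_inv]
  have := inv_natCast_mem_pIntegral (p := p) (m := 16 ^ n)
    (by have := not_dvd_of_smooth h5 (4 * n) 0 0
        rw [pow_mul] at this
        simpa using this)
  push_cast at this
  exact mul_mem (pow_mem (neg_mem (one_mem _)) _) (mul_mem (natCast_mem _ _) this)

theorem invSubTwo_sq_sub_mem (h5 : 5 < p) {l : ℕ} (h : 2 * (l + 1) < p) :
    invSubTwo p l ^ 2 - (invSucc l ^ 2 + p * invSucc l ^ 3 + 3 / 4 * p ^ 2 * invSucc l ^ 4 +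
      p ^ 3 * invSucc l ^ 5 / 2) / 4 ∈ pIdeal p 4 := by
  convert geom_pow_two_mem (half_invSucc_mem (l := l) h5 (by omega)) (invSubTwo_mem h)
    (invSubTwo_eq h) using 1
  ring

theorem sum_invSubTwo_sq_mem (hpn : p = 2 * n + 1) (h5 : 5 < p) :
    ∑ i ∈ range n, invSubTwo p i ^ 2 - (invPowSum n 2 + p * invPowSum n 3 +
      3 / 4 * p ^ 2 * invPowSum n 4 + p ^ 3 * invPowSum n 5 / 2) / 4 ∈ pIdeal p 4 := by
  simp only [invPowSum, mul_sum, sum_div, ← sum_add_distrib]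
  refine sum_sub_sum_mem_pIdeal fun l hl => ?_
  have := mem_range.1 hl
  convert invSubTwo_sq_sub_mem (l := l) h5 (by omega) using 1

theorem invSubTwo_sq_mem {i : ℕ} (hi : 2 * (i + 1) < p) : invSubTwo p i ^ 2 ∈ pIntegral p :=
  pow_mem (invSubTwo_mem hi) 2

theorem revProd_sub_mem (hpn : p = 2 * n + 1) {i : ℕ} (hi : i ≤ n) :
    revProd p i - (1 - p ^ 2 * ∑ j ∈ range i, invSubTwo p j ^ 2 + p ^ 4 *
      ∑ j ∈ range i, invSubTwo p j ^ 2 * ∑ k ∈ range j, invSubTwo p k ^ 2) ∈ pIdeal p 6 :=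
  prod_one_sub_sub_mem fun j hj => invSubTwo_sq_mem (by omega)

theorem sum_invSubTwo_sq_integral (hpn : p = 2 * n + 1) {i : ℕ} (hi : i ≤ n) :
    ∑ j ∈ range i, invSubTwo p j ^ 2 ∈ pIntegral p :=
  sum_mem fun j hj => invSubTwo_sq_mem (by have := mem_range.1 hj; omega)

theorem sum_invSubTwo_sq_sq_integral (hpn : p = 2 * n + 1) {i : ℕ} (hi : i ≤ n) :
    ∑ j ∈ range i, invSubTwo p j ^ 2 * ∑ k ∈ range j, invSubTwo p k ^ 2 ∈ pIntegral p :=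
  sum_mem fun j hj => by
    have := mem_range.1 hj
    exact mul_mem (invSubTwo_sq_mem (by omega)) (sum_invSubTwo_sq_integral hpn (by omega))

/-- Morley's congruence, by `oddProd_eq_choose`. The inverse product is 1 minus `p²` times `∑
1/(p-2j)²`, up to `p^4`, and that sum is `S_2/4 ≡ 0` modulo `p`. -/
theorem oddProd_sub_one_mem (hpn : p = 2 * n + 1) (h5 : 5 < p) :
    oddProd p n - 1 ∈ pIdeal p 3 := by
  have hn : n < p := by omega
  have h1 := pIdeal_mono (by norm_num : 3 ≤ 6) (revProd_sub_mem hpn le_rfl)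
  have h2 : ∑ i ∈ range n, invSubTwo p i ^ 2 ∈ pIdeal p 1 := by
    refine mem_pIdeal_of_natCast_mul_mem (m := 16) (by simpa using not_dvd_of_smooth h5 4 0 0) ?_
    have h := pIdeal_mono (by norm_num : 1 ≤ 4) (sum_invSubTwo_sq_mem hpn h5)
    have h3 : (p : ℚ) ^ 1 * (4 * invPowSum n 3 + 3 * p * invPowSum n 4 +
        2 * p ^ 2 * invPowSum n 5) ∈ pIdeal p 1 :=
      ⟨_, add_mem (add_mem (mul_mem (ofNat_mem _ 4) (invPowSum_mem hn 3))
        (mul_mem (mul_mem (ofNat_mem _ 3) (natCast_mem _ _)) (invPowSum_mem hn 4)))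
        (mul_mem (mul_mem (ofNat_mem _ 2) (pow_mem (natCast_mem _ _) 2)) (invPowSum_mem hn 5)),
        rfl⟩
    convert add_mem (add_mem (mul_mem_pIdeal (ofNat_mem _ 16) h)
      (mul_mem_pIdeal (ofNat_mem _ 4) (invPowSum_two_mem_pIdeal hpn h5))) h3 using 1
    push_cast
    ring
  have h3 := pow_mul_mem_pIdeal 2 h2
  have h4 : (p : ℚ) ^ 3 * (p * ∑ j ∈ range n, invSubTwo p j ^ 2 *
      ∑ k ∈ range j, invSubTwo p k ^ 2) ∈ pIdeal p 3 :=
    ⟨_, mul_mem (natCast_mem _ _) (sum_invSubTwo_sq_sq_integral hpn le_rfl), rfl⟩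
  have h6 : revProd p n - 1 ∈ pIdeal p 3 := by
    convert add_mem (sub_mem h1 h3) h4 using 1
    ring
  convert mul_mem_pIdeal (neg_mem (oddProd_mem hpn h5)) h6 using 1
  linear_combination oddProd_mul_revProd hpn

theorem invPowSum_succ (i s : ℕ) : invPowSum (i + 1) s = invPowSum i s + invSucc i ^ s :=
  sum_range_succ _ _

theorem sum_mul_invPowSum_succ (n a b : ℕ) :
    ∑ i ∈ range n, invSucc i ^ b * invPowSum (i + 1) a =
      invPowSum₂ n a b + invPowSum n (a + b) := by
  rw [invPowSum₂, invPowSum, ← sum_add_distrib]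
  refine sum_congr rfl fun i _ => ?_
  rw [invPowSum_succ, pow_add]
  ring

theorem sum_invSubTwo_sq_sub_mem (hpn : p = 2 * n + 1) (h5 : 5 < p) {i : ℕ} (hi : i ≤ n) :
    ∑ j ∈ range i, invSubTwo p j ^ 2 - (invPowSum i 2 + p * invPowSum i 3 +
      3 / 4 * p ^ 2 * invPowSum i 4) / 4 ∈ pIdeal p 3 := by
  simp only [invPowSum, mul_sum, sum_div, ← sum_add_distrib]
  refine sum_sub_sum_mem_pIdeal fun l hl => ?_
  have := mem_range.1 hl
  have h1 := pIdeal_mono (by norm_num : 3 ≤ 4) (invSubTwo_sq_sub_mem (p := p) (l := l) h5 (by omega))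
  have h2 : (p : ℚ) ^ 3 * (invSucc l ^ 5 * (2⁻¹ * (2⁻¹ * 2⁻¹))) ∈ pIdeal p 3 :=
    ⟨_, mul_mem (pow_mem (invSucc_mem (by omega)) 5) (mul_mem (inv_two_mem h5)
      (mul_mem (inv_two_mem h5) (inv_two_mem h5))), rfl⟩
  convert add_mem h1 h2 using 1
  ring

/-- The reversed sum `T` is divisible by `p`, so replacing the factor `oddProd p n` by 1 costs only
`p³ · p`. -/
theorem sum_oddTerm_div_expansion_mem (hpn : p = 2 * n + 1) (h5 : 5 < p) :
    4 * ∑ k ∈ range n, oddTerm (2 * n + 1) k / (2 * k + 1) - (2 * harmonicQuot p - p ^ 2 *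
      ∑ i ∈ range n, invSucc i * invSubTwo p i * ∑ j ∈ range (i + 1), invSubTwo p j ^ 2) ∈
      pIdeal p 4 := by
  set T := ∑ i ∈ range n, invSucc i * invSubTwo p i * revProd p (i + 1) with hT
  set E := ∑ i ∈ range n, invSucc i * invSubTwo p i * ∑ j ∈ range (i + 1), invSubTwo p j ^ 2
    with hE
  have hη : 2 * harmonicQuot p = ∑ i ∈ range n, invSucc i * invSubTwo p i := by
    rw [harmonicQuot_eq_parity hpn, mul_sum]
    exact sum_congr rfl fun i _ => by ring
  have hEm : E ∈ pIntegral p := sum_mem fun i hi => by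
    have := mem_range.1 hi
    exact mul_mem (mul_mem (invSucc_mem (by omega)) (invSubTwo_mem (by omega)))
      (sum_invSubTwo_sq_integral hpn (by omega))
  have h1 : T - (2 * harmonicQuot p - p ^ 2 * E) ∈ pIdeal p 4 := by
    rw [hη, hE, mul_sum, ← sum_sub_distrib]
    refine sum_sub_sum_mem_pIdeal fun i hi => ?_
    have := mem_range.1 hi
    have hm : invSucc i * invSubTwo p i ∈ pIntegral p :=
      mul_mem (invSucc_mem (by omega)) (invSubTwo_mem (by omega))
    have h2 := pIdeal_mono (by norm_num : 4 ≤ 6)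
      (revProd_sub_mem (i := i + 1) hpn (by omega))
    have h3 : (p : ℚ) ^ 4 * ∑ j ∈ range (i + 1), invSubTwo p j ^ 2 *
        ∑ k ∈ range j, invSubTwo p k ^ 2 ∈ pIdeal p 4 :=
      ⟨_, sum_invSubTwo_sq_sq_integral hpn (by omega), rfl⟩
    convert mul_mem_pIdeal hm (add_mem h2 h3) using 1
    ring
  have hT1 : T ∈ pIdeal p 1 := by
    have h2 : (p : ℚ) ^ 1 * (p * E) ∈ pIdeal p 1 := ⟨_, mul_mem (natCast_mem _ _) hEm, rfl⟩
    convert sub_mem (add_mem (pIdeal_mono (by norm_num) h1)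
      (mul_mem_pIdeal (ofNat_mem _ 2) (harmonicQuot_mem hpn h5))) h2 using 1
    ring
  rw [sum_oddTerm_div hpn]
  convert add_mem h1 (mul_mem_pIdeal_add (oddProd_sub_one_mem hpn h5) hT1) using 1
  ring

theorem sum_weighted_invSubTwo_sq_mem (hpn : p = 2 * n + 1) (h5 : 5 < p) :
    16 * ∑ i ∈ range n, invSucc i * invSubTwo p i * ∑ j ∈ range (i + 1), invSubTwo p j ^ 2 +
      (2 * (invPowSum₂ n 2 2 + invPowSum n 4) + p * (invPowSum₂ n 2 3 + 2 * invPowSum₂ n 3 2 +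
        3 * invPowSum n 5)) ∈ pIdeal p 2 := by
  have key : ∑ i ∈ range n, invSucc i * invSubTwo p i * ∑ j ∈ range (i + 1), invSubTwo p j ^ 2 -
      ∑ i ∈ range n, -(invSucc i ^ 2 / 2 + p * invSucc i ^ 3 / 4) *
        ((invPowSum (i + 1) 2 + p * invPowSum (i + 1) 3) / 4) ∈ pIdeal p 2 := by
    refine sum_sub_sum_mem_pIdeal fun i hi => ?_
    have := mem_range.1 hi
    have hu : invSucc i ∈ pIntegral p := invSucc_mem (by omega)
    have ha : invSucc i / 2 ∈ pIntegral p := half_invSucc_mem h5 (by omega)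
    have h2 := inv_two_mem h5
    refine mul_sub_mul_mem_pIdeal (sum_invSubTwo_sq_integral hpn (by omega)) ?_ ?_ ?_
    · convert neg_mem (add_mem (mul_mem hu ha) (mul_mem (mul_mem (natCast_mem _ p)
        (pow_mem ha 2)) hu)) using 1
      ring
    · refine mem_pIdeal_of_eq (c := invSucc i * (invSucc i / 2) ^ 2 * invSubTwo p i)
        (mul_mem (mul_mem hu (pow_mem ha 2)) (invSubTwo_mem (by omega))) ?_
      linear_combination (invSucc i * (1 + p * (invSucc i / 2))) *
        invSubTwo_eq (p := p) (l := i) (by omega)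
    · have h3 := pIdeal_mono (by norm_num : 2 ≤ 3)
        (sum_invSubTwo_sq_sub_mem (i := i + 1) hpn h5 (by omega))
      have h4 : (p : ℚ) ^ 2 * (3 * invPowSum (i + 1) 4 * (2⁻¹ ^ 4)) ∈ pIdeal p 2 :=
        ⟨_, mul_mem (mul_mem (ofNat_mem _ 3) (invPowSum_mem (by omega) 4)) (pow_mem h2 4), rfl⟩
      convert add_mem h3 h4 using 1
      ring
  have h33 : (p : ℚ) ^ 2 * ∑ i ∈ range n, invSucc i ^ 3 * invPowSum (i + 1) 3 ∈ pIdeal p 2 :=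
    ⟨_, sum_mem fun i hi => by
      have := mem_range.1 hi
      exact mul_mem (pow_mem (invSucc_mem (by omega)) 3) (invPowSum_mem (by omega) 3), rfl⟩
  convert sub_mem (mul_mem_pIdeal (ofNat_mem _ 16) key) h33 using 1
  have e : ∑ i ∈ range n, -(invSucc i ^ 2 / 2 + p * invSucc i ^ 3 / 4) *
        ((invPowSum (i + 1) 2 + p * invPowSum (i + 1) 3) / 4) =
      -(2 * ∑ i ∈ range n, invSucc i ^ 2 * invPowSum (i + 1) 2 +
        p * (2 * ∑ i ∈ range n, invSucc i ^ 2 * invPowSum (i + 1) 3 +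
          ∑ i ∈ range n, invSucc i ^ 3 * invPowSum (i + 1) 2) +
        p ^ 2 * ∑ i ∈ range n, invSucc i ^ 3 * invPowSum (i + 1) 3) / 16 := by
    simp only [mul_sum, ← sum_add_distrib, ← sum_neg_distrib, sum_div]
    exact sum_congr rfl fun i _ => by ring
  rw [e, sum_mul_invPowSum_succ, sum_mul_invPowSum_succ, sum_mul_invPowSum_succ]
  ring

theorem sum_choose_div_neg_sixteen_pow_mem (hpn : p = 2 * n + 1) (h5 : 5 < p) :
    ∑ k ∈ range n, ((2 * k).choose k : ℚ) / ((-16) ^ k * (2 * k + 1) ^ 2) -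
      (harmonicQuot p / 5 + 7 / 200 * p ^ 3 * bernoulli (p - 5)) ∈ pIdeal p 4 := by
  refine mem_pIdeal_of_natCast_mul_mem (m := 400) (by simpa using not_dvd_of_smooth h5 4 0 2) ?_
  have e := sum_choose_div_neg_sixteen_pow n
  rw [sum_one_div_odd_sq hpn] at e
  have hO := sum_invSubTwo_sq_mem hpn h5
  have hT := sum_oddTerm_div_expansion_mem hpn h5
  have hE := pow_mul_mem_pIdeal 2 (sum_weighted_invSubTwo_sq_mem hpn h5)
  have h2 := invPowSum_two_mem hpn h5
  have h3 := invPowSum_three_mem hpn h5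
  have h4 := pow_mul_mem_pIdeal 2 (invPowSum_four_mem hpn h5)
  have h22 := pow_mul_mem_pIdeal 2 (invPowSum₂_two_two_mem hpn h5)
  have hh5 := pow_mul_mem_pIdeal 3 (invPowSum_five_add_mem hpn h5)
  have h23 := pow_mul_mem_pIdeal 3 (invPowSum₂_two_three_mem hpn h5)
  have h32 := pow_mul_mem_pIdeal 3 (invPowSum₂_three_two_mem hpn h5)
  -- The multipliers eliminate `S_2`, …, `S_5` and the double sums, leaving `H_{p-1}/p` and `p³
  -- B_{p-5}`.
  have := add_mem (add_mem (add_mem (add_mem (add_mem (add_mem (add_mem (add_mem (add_mem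
    (mul_mem_pIdeal (ofNat_mem _ 320) hO) (mul_mem_pIdeal (ofNat_mem _ 80) hT))
    (mul_mem_pIdeal (neg_mem (ofNat_mem _ 5)) hE)) (mul_mem_pIdeal (ofNat_mem _ 8) h2))
    (mul_mem_pIdeal (neg_mem (ofNat_mem _ 8)) h3)) (mul_mem_pIdeal (ofNat_mem _ 14) h4))
    (mul_mem_pIdeal (ofNat_mem _ 2) h22)) (mul_mem_pIdeal (ofNat_mem _ 55) hh5))
    (mul_mem_pIdeal (ofNat_mem _ 5) h23)) (mul_mem_pIdeal (ofNat_mem _ 10) h32)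
  convert this using 1
  push_cast
  linear_combination 320 * e

end

/-! ### Alternating sums -/

/-- The alternating sum of `(-1) ^ k / k ^ s` over `1 ≤ k ≤ n`. -/
def altSum (n s : ℕ) : ℚ := ∑ l ∈ range n, (-1) ^ (l + 1) * invSucc l ^ s

/-- The alternating sum of `(-1) ^ k / (p - 2 k) ^ s` over `1 ≤ k ≤ n`. -/
def altSubTwo (p n s : ℕ) : ℚ := ∑ l ∈ range n, (-1) ^ (l + 1) * invSubTwo p l ^ s

theorem sum_signed_sub_eq {p n : ℕ} (hpn : p = 2 * n + 1) (s : ℕ) :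
    ∑ l ∈ range n, (-1) ^ (l + 1) * (invSucc l ^ s - invSub p l ^ s) =
      ∑ l ∈ range n, ((invSucc l / 2) ^ s - invSubTwo p l ^ s) :=
  (sum_signed_inv_pow_eq_reflect hpn s).symm.trans (sum_signed_inv_pow_eq_parity hpn s)

theorem half_invSub_eq {p l : ℕ} (h : 2 * (l + 1) < p) :
    invSub p l / 2 = invSubTwo p l - p * invSubTwo p l * (invSub p l / 2) := by
  linear_combination (-invSub p l / 2) * sub_mul_invSubTwo h +
    invSubTwo p l * sub_mul_invSub (p := p) (l := l) (by omega)

section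

variable {p n : ℕ} [hp : Fact p.Prime]

theorem neg_one_pow_mem (k : ℕ) : (-1 : ℚ) ^ k ∈ pIntegral p := pow_mem (neg_mem (one_mem _)) k

theorem half_invSub_mem (h5 : 5 < p) {l : ℕ} (h : l + 1 < p) : invSub p l / 2 ∈ pIntegral p := by
  rw [div_eq_mul_inv]
  exact mul_mem (invSub_mem h) (inv_two_mem h5)

theorem sum_sub_invSubTwo (hpn : p = 2 * n + 1) :
    ∑ l ∈ range n, (invSucc l / 2 - invSubTwo p l) = invPowSum n 1 - p * harmonicQuot p := by
  have h := sum_inv_pow_eq_parity hpn 1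
  simp only [pow_one] at h
  rw [harmonicQuot, harmonic, h, mul_div_cancel₀ _ cast_prime_ne_zero, invPowSum, ← sum_sub_distrib]
  exact sum_congr rfl fun l _ => by ring

/-- With `w = 1/(p-2k)`, `1/(2k) = -w/(1-pw)` and `1/(2(p-k)) = w/(1+pw)`. Their difference is
`-2w/(1-p²w²)`, so only odd powers of `w` survive; the signed sum on the left is known from the
parity splitting. -/
theorem altSubTwo_one_add_mem (hpn : p = 2 * n + 1) (h5 : 5 < p) :
    altSubTwo p n 1 + (invPowSum n 1 - p * harmonicQuot p) / 4 + p ^ 2 * altSubTwo p n 3 +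
      p ^ 4 * altSubTwo p n 5 ∈ pIdeal p 5 := by
  have e := sum_signed_sub_eq hpn 1
  simp only [pow_one] at e
  rw [← sum_sub_invSubTwo hpn, ← e]
  simp only [altSubTwo, mul_sum, sum_div, ← sum_add_distrib]
  refine sum_mem fun l hl => ?_
  have := mem_range.1 hl
  have ha : invSucc l / 2 ∈ pIntegral p := half_invSucc_mem h5 (by omega)
  have hc : invSub p l / 2 ∈ pIntegral p := half_invSub_mem h5 (by omega)
  have hw : invSubTwo p l ∈ pIntegral p := invSubTwo_mem (by omega)
  have h1 := half_invSub_eq (p := p) (l := l) (by omega)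
  have h2 := invSubTwo_eq (p := p) (l := l) (by omega)
  set a := invSucc l / 2 with had
  set c := invSub p l / 2 with hcd
  set w := invSubTwo p l
  rw [show invSucc l = 2 * a by rw [had]; ring, show invSub p l = 2 * c by rw [hcd]; ring]
  -- The witness collects the remainders `p^5 w^5 a` and `-p^5 w^5 c` of the two truncated geometric
  -- series.
  refine mem_pIdeal_of_eq (c := (-1) ^ (l + 1) * (2⁻¹ * (w ^ 5 * (a + c))))
    (mul_mem (neg_one_pow_mem _) (mul_mem (inv_two_mem h5)
      (mul_mem (pow_mem hw 5) (add_mem ha hc)))) ?_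
  linear_combination (-1) ^ (l + 1) / 2 *
    ((1 + p * w + p ^ 2 * w ^ 2 + p ^ 3 * w ^ 3 + p ^ 4 * w ^ 4) * h2 -
    (1 - p * w + p ^ 2 * w ^ 2 - p ^ 3 * w ^ 3 + p ^ 4 * w ^ 4) * h1)

theorem altSubTwo_three_add_mem (hpn : p = 2 * n + 1) (h5 : 5 < p) :
    16 * altSubTwo p n 3 + 96 * p ^ 2 * altSubTwo p n 5 + (invPowSum n 3 / 4 +
      3 / 16 * p * invPowSum n 4 + 3 / 16 * p ^ 2 * invPowSum n 5) ∈ pIdeal p 3 := by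
  have h1 : 16 * altSubTwo p n 3 + 96 * p ^ 2 * altSubTwo p n 5 +
      ∑ l ∈ range n, (-1) ^ (l + 1) * (invSucc l ^ 3 - invSub p l ^ 3) ∈ pIdeal p 3 := by
    simp only [altSubTwo, mul_sum, ← sum_add_distrib]
    refine sum_mem fun l hl => ?_
    have := mem_range.1 hl
    have hw : invSubTwo p l ∈ pIntegral p := invSubTwo_mem (by omega)
    have h2 := geom_pow_three_mem hw (half_invSucc_mem (l := l) h5 (by omega))
      (by linear_combination invSubTwo_eq (p := p) (l := l) (by omega))
    have h3 := geom_pow_three_mem (neg_mem hw) (half_invSub_mem (l := l) h5 (by omega))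
      (by linear_combination half_invSub_eq (p := p) (l := l) (by omega))
    convert mul_mem_pIdeal (mul_mem (ofNat_mem _ 8) (neg_one_pow_mem (l + 1)))
      (sub_mem h2 h3) using 1
    ring
  have h2 : ∑ l ∈ range n, ((invSucc l / 2) ^ 3 - invSubTwo p l ^ 3) - (invPowSum n 3 / 4 +
      3 / 16 * p * invPowSum n 4 + 3 / 16 * p ^ 2 * invPowSum n 5) ∈ pIdeal p 3 := by
    simp only [invPowSum, mul_sum, sum_div, ← sum_add_distrib]
    refine sum_sub_sum_mem_pIdeal fun l hl => ?_
    have := mem_range.1 hl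
    convert neg_mem (geom_pow_three_mem (half_invSucc_mem (l := l) h5 (by omega))
      (invSubTwo_mem (by omega)) (invSubTwo_eq (p := p) (l := l) (by omega))) using 1
    ring
  convert sub_mem h1 h2 using 1
  rw [sum_signed_sub_eq hpn 3]
  ring

theorem two_mul_invSubTwo_add_mem {l : ℕ} (h : 2 * (l + 1) < p) :
    2 * invSubTwo p l - -invSucc l ∈ pIdeal p 1 :=
  mem_pIdeal_of_eq (mul_mem (invSucc_mem (l := l) (by omega)) (invSubTwo_mem h))
    (by linear_combination 2 * invSubTwo_eq h)

theorem invSub_add_mem {l : ℕ} (h : l + 1 < p) : invSub p l - -invSucc l ∈ pIdeal p 1 :=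
  mem_pIdeal_of_eq (mul_mem (invSucc_mem h) (invSub_mem h)) (by linear_combination invSub_eq h)

theorem altSubTwo_five_add_mem (hpn : p = 2 * n + 1) :
    32 * altSubTwo p n 5 + altSum n 5 ∈ pIdeal p 1 := by
  simp only [altSubTwo, altSum, mul_sum, ← sum_add_distrib]
  refine sum_mem fun l hl => ?_
  have := mem_range.1 hl
  convert mul_mem_pIdeal (neg_one_pow_mem (l + 1)) (pow_sub_pow_mem
    (mul_mem (ofNat_mem _ 2) (invSubTwo_mem (by omega))) (neg_mem (invSucc_mem (by omega)))
    (two_mul_invSubTwo_add_mem (p := p) (l := l) (by omega)) 5) using 1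
  ring

theorem altSum_five_mem (hpn : p = 2 * n + 1) (h5 : 5 < p) :
    32 * altSum n 5 - invPowSum n 5 ∈ pIdeal p 1 := by
  refine mem_pIdeal_of_natCast_mul_mem (m := 2) (not_dvd_of_smooth h5 1 0 0) ?_
  have h1 : ∑ l ∈ range n, (-1) ^ (l + 1) * (invSucc l ^ 5 - invSub p l ^ 5) -
      2 * altSum n 5 ∈ pIdeal p 1 := by
    rw [altSum, mul_sum]
    refine sum_sub_sum_mem_pIdeal fun l hl => ?_
    have := mem_range.1 hl
    convert mul_mem_pIdeal (neg_mem (neg_one_pow_mem (l + 1))) (pow_sub_pow_mem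
      (invSub_mem (by omega)) (neg_mem (invSucc_mem (by omega)))
      (invSub_add_mem (p := p) (l := l) (by omega)) 5) using 1
    ring
  have h2 : 32 * ∑ l ∈ range n, ((invSucc l / 2) ^ 5 - invSubTwo p l ^ 5) -
      2 * invPowSum n 5 ∈ pIdeal p 1 := by
    rw [invPowSum, mul_sum, mul_sum]
    refine sum_sub_sum_mem_pIdeal fun l hl => ?_
    have := mem_range.1 hl
    convert neg_mem (pow_sub_pow_mem
      (mul_mem (ofNat_mem _ 2) (invSubTwo_mem (by omega))) (neg_mem (invSucc_mem (by omega)))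
      (two_mul_invSubTwo_add_mem (p := p) (l := l) (by omega)) 5) using 1
    ring
  convert sub_mem h2 (mul_mem_pIdeal (ofNat_mem _ 32) h1) using 1
  rw [sum_signed_sub_eq hpn 5]
  push_cast
  ring

/-! ### The triple sum -/

/-- Numerator and denominator of each factor add up to `p`, so the factor is -1 modulo `p`. -/
theorem shiftedRatio_zero_mem (hpn : p = 2 * n + 1) {l : ℕ} (hl : l ≤ n) :
    shiftedRatio 0 n l - (-1) ^ l ∈ pIdeal p 1 ∧ shiftedRatio 0 n l ∈ pIntegral p := by
  induction l with
  | zero => exact ⟨by simp [shiftedRatio_zero], by simp [shiftedRatio_zero]⟩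
  | succ l ih =>
    obtain ⟨h1, h2⟩ := ih (by omega)
    have hinv := inv_natCast_mem_pIntegral (p := p) (m := n + 1 + l)
      (Nat.not_dvd_of_pos_of_lt (by omega) (by omega))
    push_cast at hinv
    have h3 : ((n : ℚ) - l) / (n + 1 + l - 0) ∈ pIntegral p := by
      rw [sub_zero, div_eq_mul_inv]
      exact mul_mem (sub_mem (natCast_mem _ _) (natCast_mem _ _)) hinv
    have h4 : ((n : ℚ) - l) / (n + 1 + l - 0) - -1 ∈ pIdeal p 1 := by
      refine mem_pIdeal_of_eq hinv ?_
      have : (n : ℚ) + 1 + l ≠ 0 := by positivity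
      rw [show (p : ℚ) = 2 * n + 1 by rw [hpn]; push_cast; rfl, sub_zero]
      field_simp
      ring
    rw [shiftedRatio_succ, pow_succ]
    exact ⟨mul_sub_mul_mem_pIdeal h3 (neg_one_pow_mem l) h1 h4, mul_mem h2 h3⟩

theorem starSum_sub_mem (hpn : p = 2 * n + 1) (a : ℕ) :
    starSum a n - 2 * altSum n (2 * a + 1) ∈ pIdeal p 1 := by
  rw [starSum_eq, altSum, ← mul_sub]
  refine mul_mem_pIdeal (ofNat_mem _ 2) (sum_sub_sum_mem_pIdeal fun l hl => ?_)
  have := mem_range.1 hl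
  rw [show ((l : ℚ) + 1)⁻¹ = invSucc l from rfl, ← sub_mul, mul_comm]
  exact mul_mem_pIdeal (pow_mem (invSucc_mem (l := l) (by omega)) _)
    (shiftedRatio_zero_mem (p := p) (l := l + 1) hpn (by omega)).1

theorem starSum_mem (hpn : p = 2 * n + 1) (a : ℕ) : starSum a n ∈ pIntegral p := by
  have h : altSum n (2 * a + 1) ∈ pIntegral p := sum_mem fun l hl =>
    mul_mem (neg_one_pow_mem _) (pow_mem (invSucc_mem (by have := mem_range.1 hl; omega)) _)
  convert add_mem (mem_pIntegral_of_mem_pIdeal (starSum_sub_mem hpn a))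
    (mul_mem (ofNat_mem _ 2) h) using 1
  ring

/-- In `strictSum_eq_starSum` the symmetric functions `S_2` and `invPowSum₂ n 2 2` are divisible by
`p`; only the star sum of depth 3 remains. -/
theorem strictSum_sub_mem (hpn : p = 2 * n + 1) (h5 : 5 < p) :
    strictSum n - 2 * altSum n 5 ∈ pIdeal p 1 := by
  have hn : n < p := by omega
  have h1 := mul_mem_pIdeal (starSum_mem hpn 1) (invPowSum_two_mem_pIdeal hpn h5)
  have h22 : invPowSum₂ n 2 2 ∈ pIdeal p 1 := by
    refine mem_pIdeal_of_natCast_mul_mem (m := 5) (not_dvd_of_smooth h5 0 0 1) ?_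
    have hb : (p : ℚ) ^ 1 * (31 * bernoulli (p - 5)) ∈ pIdeal p 1 :=
      ⟨_, mul_mem (ofNat_mem _ 31) (bernoulli_mem (by omega)), rfl⟩
    convert sub_mem (pIdeal_mono (by norm_num : 1 ≤ 2) (invPowSum₂_two_two_mem hpn h5)) hb using 1
    push_cast
    ring
  have h2 := mul_mem_pIdeal (starSum_mem hpn 0) h22
  convert add_mem (sub_mem (starSum_sub_mem hpn 2) h1) h2 using 1
  rw [strictSum_eq_starSum]
  simp only [invPowSum₂, invPowSum, invSucc]
  ring

end

/-! ### The product identity at a prime -/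

theorem shiftedRatio_self {p n : ℕ} (hpn : p = 2 * n + 1) {l : ℕ} (hl : l ≤ n) :
    shiftedRatio p n l = (-1) ^ l := by
  rw [shiftedRatio, ← card_range l, ← prod_const, card_range]
  refine prod_congr rfl fun i hi => ?_
  have : (i : ℚ) + 1 ≤ n := by exact_mod_cast (by have := mem_range.1 hi; omega : i + 1 ≤ n)
  rw [show (p : ℚ) = 2 * n + 1 by rw [hpn]; push_cast; rfl, div_eq_iff (by linarith)]
  ring

/-- The product of `1 - p² / (4 j (p - j))` over `1 ≤ j ≤ i`. -/
def reflProd (p i : ℕ) : ℚ := ∏ j ∈ range i, (1 - (p : ℚ) ^ 2 * (invSucc j * invSub p j / 4))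

/-- Since `p² - 4j(p-j) = (p-2j)²`, the factors with the same `j` are mutually inverse. -/
theorem reflProd_mul_revProd {p n : ℕ} (hpn : p = 2 * n + 1) :
    reflProd p n * revProd p n = 1 := by
  rw [reflProd, revProd, ← prod_mul_distrib]
  refine prod_eq_one fun j hj => ?_
  have hj' := mem_range.1 hj
  linear_combination -(p : ℚ) ^ 2 * ((invSub p j / 2 * (1 + p * invSubTwo p j)) *
    invSubTwo_eq (p := p) (l := j) (by omega) -
    invSubTwo p j * half_invSub_eq (p := p) (l := j) (by omega))

theorem reflProd_eq_oddProd {p n : ℕ} (hpn : p = 2 * n + 1) : reflProd p n = oddProd p n :=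
  mul_right_cancel₀ (right_ne_zero_of_mul_eq_one (oddProd_mul_revProd hpn))
    ((reflProd_mul_revProd hpn).trans (oddProd_mul_revProd hpn).symm)

/-- The parametric identity at `q = p`, where `shiftedRatio p n l` is exactly `(-1)^l`. -/
theorem sum_invSub_mul_reflProd {p n : ℕ} (hpn : p = 2 * n + 1) :
    ∑ i ∈ range n, invSub p i * reflProd p i = 4 * (oddProd p n * altSubTwo p n 1) := by
  have h := sum_prod_eq_prod_mul_sum_shiftedRatio (q := p) (n := n) fun j _ hj =>
    sub_ne_zero.2 (by exact_mod_cast (by omega : j ≠ p))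
  have hP : ∀ i, ∏ j ∈ range i, (1 + (p : ℚ) ^ 2 / 4 / (((j : ℚ) + 1) * (j + 1 - p))) =
      reflProd p i := fun i => prod_congr rfl fun j _ => by
    rw [invSucc, invSub, ← neg_sub ((p : ℚ)), mul_neg, div_neg, div_eq_mul_inv, mul_inv]
    ring
  simp only [hP] at h
  have e1 : ∑ i ∈ range n, invSub p i * reflProd p i =
      -∑ i ∈ range n, 1 / ((i : ℚ) + 1 - p) * reflProd p i := by
    rw [← sum_neg_distrib]
    refine sum_congr rfl fun i _ => ?_
    rw [invSub, ← neg_sub ((p : ℚ)), div_neg, one_div]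
    ring
  rw [e1, h, reflProd_eq_oddProd hpn, altSubTwo, mul_left_comm, ← mul_neg, ← sum_neg_distrib,
    mul_sum _ _ (4 : ℚ)]
  refine congr_arg _ (sum_congr rfl fun l hl => ?_)
  rw [shiftedRatio_self (l := l + 1) hpn (mem_range.1 hl), invSubTwo, ← neg_sub ((p : ℚ)), div_neg,
    div_eq_mul_inv]
  ring

section

variable {p n : ℕ} [hp : Fact p.Prime]

theorem sum_invSub (hpn : p = 2 * n + 1) :
    ∑ l ∈ range n, invSub p l = p * harmonicQuot p - invPowSum n 1 := by
  have h := sum_inv_pow_eq_reflect hpn 1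
  simp only [pow_one] at h
  rw [harmonicQuot, harmonic, h, mul_div_cancel₀ _ cast_prime_ne_zero, invPowSum, ← sum_sub_distrib]
  exact sum_congr rfl fun l _ => by ring

theorem invSucc_mul_invSub_mem (hpn : p = 2 * n + 1) {l : ℕ} (h : l < n) :
    invSucc l * invSub p l ∈ pIntegral p :=
  mul_mem (invSucc_mem (by omega)) (invSub_mem (by omega))

theorem oddProd_mul_altSubTwo_mem (hpn : p = 2 * n + 1) (h5 : 5 < p) :
    4 * (oddProd p n * altSubTwo p n 1) - (p * harmonicQuot p - invPowSum n 1 -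
      p ^ 2 / 4 * ∑ i ∈ range n, invSub p i * ∑ j ∈ range i, invSucc j * invSub p j +
      p ^ 4 / 16 * ∑ i ∈ range n, invSub p i * ∑ j ∈ range i, invSucc j * invSub p j *
        ∑ k ∈ range j, invSucc k * invSub p k) ∈ pIdeal p 5 := by
  rw [← sum_invSub_mul_reflProd hpn, ← sum_invSub hpn, mul_sum, mul_sum, ← sum_sub_distrib,
    ← sum_add_distrib]
  refine sum_sub_sum_mem_pIdeal fun i hi => ?_
  have hi' := mem_range.1 hi
  have h := pIdeal_mono (by norm_num : 5 ≤ 6) (prod_one_sub_sub_mem (p := p) (i := i)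
    (f := fun j => invSucc j * invSub p j / 4) fun j hj => by
      rw [show invSucc j * invSub p j / 4 = invSucc j / 2 * (invSub p j / 2) by ring]
      exact mul_mem (half_invSucc_mem h5 (by omega)) (half_invSub_mem h5 (by omega)))
  convert mul_mem_pIdeal (invSub_mem (p := p) (l := i) (by omega)) h using 1
  have e : ∑ j ∈ range i, invSucc j * invSub p j / 4 * ∑ k ∈ range j, invSucc k * invSub p k / 4 =
      (∑ j ∈ range i, invSucc j * invSub p j * ∑ k ∈ range j, invSucc k * invSub p k) / 16 := by
    rw [sum_div]
    exact sum_congr rfl fun j _ => by rw [← sum_div]; ring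
  rw [e, ← sum_div, reflProd]
  ring

/-! ### Nested sums -/

theorem sum_invSucc_mul_invSub_add_mem (hpn : p = 2 * n + 1) {i : ℕ} (hi : i ≤ n) :
    ∑ j ∈ range i, invSucc j * invSub p j - -(invPowSum i 2 + p * invPowSum i 3 +
      p ^ 2 * invPowSum i 4) ∈ pIdeal p 3 := by
  simp only [invPowSum, mul_sum, ← sum_add_distrib, ← sum_neg_distrib]
  refine sum_sub_sum_mem_pIdeal fun l hl => ?_
  have := mem_range.1 hl
  refine mem_pIdeal_of_eq (mul_mem (pow_mem (invSucc_mem (p := p) (l := l) (by omega)) 4)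
    (invSub_mem (p := p) (l := l) (by omega))) ?_
  linear_combination invSucc l * (1 + p * invSucc l + p ^ 2 * invSucc l ^ 2) *
    invSub_eq (p := p) (l := l) (by omega)

theorem sum_invSucc_mul_sum_invSubTwo_sq_mem (hpn : p = 2 * n + 1) (h5 : 5 < p) :
    4 * ∑ i ∈ range n, invSucc i * ∑ j ∈ range (i + 1), invSubTwo p j ^ 2 -
      (invPowSum₂ n 2 1 + invPowSum n 3 + p * (invPowSum₂ n 3 1 + invPowSum n 4) +
        3 / 4 * p ^ 2 * (invPowSum₂ n 4 1 + invPowSum n 5)) ∈ pIdeal p 3 := by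
  rw [← sum_mul_invPowSum_succ n 2 1, ← sum_mul_invPowSum_succ n 3 1,
    ← sum_mul_invPowSum_succ n 4 1]
  simp only [mul_sum (range n), ← sum_add_distrib]
  refine sum_sub_sum_mem_pIdeal fun i hi => ?_
  have := mem_range.1 hi
  convert mul_mem_pIdeal (mul_mem (ofNat_mem _ 4) (invSucc_mem (l := i) (by omega)))
    (sum_invSubTwo_sq_sub_mem (i := i + 1) hpn h5 (by omega)) using 1
  ring

theorem sum_invSub_mul_sum_mem (hpn : p = 2 * n + 1) :
    ∑ i ∈ range n, invSub p i * ∑ j ∈ range i, invSucc j * invSub p j -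
      (invPowSum₂ n 2 1 + p * (invPowSum₂ n 3 1 + invPowSum₂ n 2 2) +
        p ^ 2 * (invPowSum₂ n 4 1 + invPowSum₂ n 3 2 + invPowSum₂ n 2 3)) ∈ pIdeal p 3 := by
  have key : ∑ i ∈ range n, invSub p i * ∑ j ∈ range i, invSucc j * invSub p j -
      ∑ i ∈ range n, -(invSucc i + p * invSucc i ^ 2 + p ^ 2 * invSucc i ^ 3) *
        -(invPowSum i 2 + p * invPowSum i 3 + p ^ 2 * invPowSum i 4) ∈ pIdeal p 3 := by
    refine sum_sub_sum_mem_pIdeal fun i hi => ?_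
    have := mem_range.1 hi
    have hu : invSucc i ∈ pIntegral p := invSucc_mem (by omega)
    have hpm : (p : ℚ) ∈ pIntegral p := natCast_mem _ _
    refine mul_sub_mul_mem_pIdeal (sum_mem fun j hj => invSucc_mul_invSub_mem hpn
      (by have := mem_range.1 hj; omega))
      (neg_mem (add_mem (add_mem hu (mul_mem hpm (pow_mem hu 2)))
        (mul_mem (pow_mem hpm 2) (pow_mem hu 3)))) ?_
      (sum_invSucc_mul_invSub_add_mem hpn (by omega))
    refine mem_pIdeal_of_eq (mul_mem (pow_mem hu 3) (invSub_mem (p := p) (l := i) (by omega))) ?_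
    linear_combination (1 + p * invSucc i + p ^ 2 * invSucc i ^ 2) *
      invSub_eq (p := p) (l := i) (by omega)
  have hn : n < p := by omega
  have h3 : (p : ℚ) ^ 3 * (invPowSum₂ n 4 2 + invPowSum₂ n 3 3 + p * invPowSum₂ n 4 3) ∈
      pIdeal p 3 :=
    ⟨_, add_mem (add_mem (invPowSum₂_mem hn 4 2) (invPowSum₂_mem hn 3 3))
      (mul_mem (natCast_mem _ _) (invPowSum₂_mem hn 4 3)), rfl⟩
  convert add_mem key h3 using 1
  have e : ∑ i ∈ range n, -(invSucc i + p * invSucc i ^ 2 + p ^ 2 * invSucc i ^ 3) *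
        -(invPowSum i 2 + p * invPowSum i 3 + p ^ 2 * invPowSum i 4) =
      invPowSum₂ n 2 1 + p * (invPowSum₂ n 3 1 + invPowSum₂ n 2 2) +
        p ^ 2 * (invPowSum₂ n 4 1 + invPowSum₂ n 3 2 + invPowSum₂ n 2 3) +
        p ^ 3 * (invPowSum₂ n 4 2 + invPowSum₂ n 3 3 + p * invPowSum₂ n 4 3) := by
    simp only [invPowSum₂, mul_add, mul_sum (range n), ← sum_add_distrib]
    exact sum_congr rfl fun i _ => by ring
  rw [e]
  ring

/-- The free bound `s` serves both `j ≤ i` (from `revProd`) and `j < i` (from `reflProd`). -/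
theorem nested_sum_sub_mem {f f' g g' : ℕ → ℚ} {n : ℕ} {s : ℕ → ℕ} (hs : ∀ i < n, s i ≤ n)
    (hf' : ∀ i < n, f' i ∈ pIntegral p) (hg : ∀ i < n, g i ∈ pIntegral p)
    (hg' : ∀ i < n, g' i ∈ pIntegral p) (hff : ∀ i < n, f i - f' i ∈ pIdeal p 1)
    (hgg : ∀ i < n, g i - g' i ∈ pIdeal p 1) :
    ∑ i ∈ range n, f i * ∑ j ∈ range (s i), g j * ∑ k ∈ range j, g k -
      ∑ i ∈ range n, f' i * ∑ j ∈ range (s i), g' j * ∑ k ∈ range j, g' k ∈ pIdeal p 1 := by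
  have hG : ∀ j ≤ n, ∑ k ∈ range j, g k ∈ pIntegral p := fun j hj =>
    sum_mem fun k hk => hg k (by have := mem_range.1 hk; omega)
  refine sum_sub_sum_mem_pIdeal fun i hi => ?_
  have hi' := mem_range.1 hi
  have hsi := hs i hi'
  refine mul_sub_mul_mem_pIdeal (sum_mem fun j hj => ?_) (hf' i hi') (hff i hi')
    (sum_sub_sum_mem_pIdeal fun j hj => ?_)
  · have := mem_range.1 hj
    exact mul_mem (hg j (by omega)) (hG j (by omega))
  · have := mem_range.1 hj
    exact mul_sub_mul_mem_pIdeal (hG j (by omega)) (hg' j (by omega)) (hgg j (by omega))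
      (sum_sub_sum_mem_pIdeal fun k hk => hgg k (by have := mem_range.1 hk; omega))

theorem sum_invSucc_mul_nested_invSubTwo_mem (hpn : p = 2 * n + 1) :
    16 * ∑ i ∈ range n, invSucc i * ∑ j ∈ range (i + 1), invSubTwo p j ^ 2 *
      ∑ k ∈ range j, invSubTwo p k ^ 2 - (strictSum n + invPowSum₂ n 2 3) ∈ pIdeal p 1 := by
  have h := nested_sum_sub_mem (p := p) (f := invSucc) (f' := invSucc)
    (g := fun j => (2 * invSubTwo p j) ^ 2) (g' := fun j => (-invSucc j) ^ 2) (n := n)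
    (s := fun i => i + 1) (fun i hi => hi) (fun i hi => invSucc_mem (by omega))
    (fun i hi => pow_mem (mul_mem (ofNat_mem _ 2) (invSubTwo_mem (by omega))) 2)
    (fun i hi => pow_mem (neg_mem (invSucc_mem (by omega))) 2)
    (fun i hi => by rw [sub_self]; exact zero_mem _)
    (fun i hi => pow_sub_pow_mem (mul_mem (ofNat_mem _ 2) (invSubTwo_mem (by omega)))
      (neg_mem (invSucc_mem (by omega))) (two_mul_invSubTwo_add_mem (by omega)) 2)
  convert h using 1
  congr 1
  · simp only [mul_pow, mul_sum]
    exact sum_congr rfl fun i _ => sum_congr rfl fun j _ => sum_congr rfl fun k _ => by ring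
  · rw [strictSum, invPowSum₂, ← sum_add_distrib]
    refine sum_congr rfl fun i _ => ?_
    simp only [neg_sq, sum_range_succ, invPowSum, invSucc]
    ring

theorem nested_invSub_add_mem (hpn : p = 2 * n + 1) :
    ∑ i ∈ range n, invSub p i * ∑ j ∈ range i, invSucc j * invSub p j *
      ∑ k ∈ range j, invSucc k * invSub p k + strictSum n ∈ pIdeal p 1 := by
  have h := nested_sum_sub_mem (p := p) (f := invSub p) (f' := fun i => -invSucc i)
    (g := fun j => invSucc j * invSub p j) (g' := fun j => invSucc j * -invSucc j) (n := n)
    (s := fun i => i) (fun i hi => hi.le) (fun i hi => neg_mem (invSucc_mem (by omega)))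
    (fun i hi => invSucc_mul_invSub_mem hpn hi)
    (fun i hi => mul_mem (invSucc_mem (by omega)) (neg_mem (invSucc_mem (by omega))))
    (fun i hi => invSub_add_mem (by omega))
    (fun i hi => by
      rw [← mul_sub]
      exact mul_mem_pIdeal (invSucc_mem (by omega)) (invSub_add_mem (by omega)))
  convert h using 1
  rw [sub_eq_add_neg, ← sum_neg_distrib, strictSum]
  congr 1
  refine sum_congr rfl fun i _ => ?_
  simp only [invSucc, mul_neg, neg_mul, sum_neg_distrib, neg_neg, pow_two]

theorem sum_oddTerm_expansion_mem (hpn : p = 2 * n + 1) (h5 : 5 < p) :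
    4 * ∑ k ∈ range n, oddTerm (2 * n + 1) k - oddProd p n * (invPowSum n 1 -
      p ^ 2 * ∑ i ∈ range n, invSucc i * ∑ j ∈ range (i + 1), invSubTwo p j ^ 2 +
      p ^ 4 * ∑ i ∈ range n, invSucc i * ∑ j ∈ range (i + 1), invSubTwo p j ^ 2 *
        ∑ k ∈ range j, invSubTwo p k ^ 2) ∈ pIdeal p 5 := by
  rw [sum_oddTerm hpn, mul_div_cancel₀ _ (by norm_num : (4 : ℚ) ≠ 0), ← mul_sub]
  refine mul_mem_pIdeal (oddProd_mem hpn h5) ?_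
  rw [mul_sum, mul_sum, invPowSum, ← sum_sub_distrib, ← sum_add_distrib]
  refine sum_sub_sum_mem_pIdeal fun i hi => ?_
  have := mem_range.1 hi
  convert mul_mem_pIdeal (invSucc_mem (p := p) (l := i) (by omega))
    (pIdeal_mono (by norm_num : 5 ≤ 6) (revProd_sub_mem (i := i + 1) hpn (by omega))) using 1
  ring

theorem altSubTwo_mem (hpn : p = 2 * n + 1) (s : ℕ) : altSubTwo p n s ∈ pIntegral p :=
  sum_mem fun l hl => mul_mem (neg_one_pow_mem _)
    (pow_mem (invSubTwo_mem (by have := mem_range.1 hl; omega)) s)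

/-- `H_n` cancels between the remainder and the two formulas for the alternating sum. The double
sums `invPowSum₂ n 2 1` and `invPowSum₂ n 3 1` cancel because they enter `T` and the nested sum of
the product identity with matching coefficients. -/
theorem altSubTwo_add_sum_oddTerm_mem (hpn : p = 2 * n + 1) (h5 : 5 < p) :
    altSubTwo p n 1 + ∑ k ∈ range n, oddTerm (2 * n + 1) k -
      (p * harmonicQuot p / 16 + 9 / 640 * p ^ 4 * bernoulli (p - 5)) ∈ pIdeal p 5 := by
  refine mem_pIdeal_of_natCast_mul_mem (m := 640) (by simpa using not_dvd_of_smooth h5 7 0 1) ?_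
  have hR := sum_oddTerm_expansion_mem hpn h5
  have hU := oddProd_mul_altSubTwo_mem hpn h5
  have hA := altSubTwo_one_add_mem hpn h5
  have hA3 := pow_mul_mem_pIdeal 2 (altSubTwo_three_add_mem hpn h5)
  have hA5 := pow_mul_mem_pIdeal 4 (altSubTwo_five_add_mem hpn)
  have hAt := pow_mul_mem_pIdeal 4 (altSum_five_mem hpn h5)
  have hSS := pow_mul_mem_pIdeal 4 (strictSum_sub_mem hpn h5)
  have ht := pow_mul_mem_pIdeal 2 (sum_invSucc_mul_sum_invSubTwo_sq_mem hpn h5)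
  have hD := pow_mul_mem_pIdeal 2 (sum_invSub_mul_sum_mem hpn)
  have ht2 := pow_mul_mem_pIdeal 4 (sum_invSucc_mul_nested_invSubTwo_mem hpn)
  have hD2 := pow_mul_mem_pIdeal 4 (nested_invSub_add_mem hpn)
  have hδ := oddProd_sub_one_mem hpn h5
  have h3 := pow_mul_mem_pIdeal 1 (invPowSum_three_mem hpn h5)
  have h4 := pow_mul_mem_pIdeal 3 (invPowSum_four_mem hpn h5)
  have h22 := pow_mul_mem_pIdeal 3 (invPowSum₂_two_two_mem hpn h5)
  have hh5 := pow_mul_mem_pIdeal 4 (invPowSum_five_add_mem hpn h5)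
  have h41 := pow_mul_mem_pIdeal 4 (invPowSum₂_four_one_mem hpn h5)
  have h32 := pow_mul_mem_pIdeal 4 (invPowSum₂_three_two_mem hpn h5)
  have h23 := pow_mul_mem_pIdeal 4 (invPowSum₂_two_three_mem hpn h5)
  have hmt : ∑ i ∈ range n, invSucc i * ∑ j ∈ range (i + 1), invSubTwo p j ^ 2 ∈ pIntegral p :=
    sum_mem fun i hi => by
      have := mem_range.1 hi
      exact mul_mem (invSucc_mem (by omega)) (sum_invSubTwo_sq_integral hpn (by omega))
  have hmt2 : ∑ i ∈ range n, invSucc i * ∑ j ∈ range (i + 1), invSubTwo p j ^ 2 *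
      ∑ k ∈ range j, invSubTwo p k ^ 2 ∈ pIntegral p :=
    sum_mem fun i hi => by
      have := mem_range.1 hi
      exact mul_mem (invSucc_mem (by omega)) (sum_invSubTwo_sq_sq_integral hpn (by omega))
  set T := ∑ i ∈ range n, invSucc i * ∑ j ∈ range (i + 1), invSubTwo p j ^ 2
  set T2 := ∑ i ∈ range n, invSucc i * ∑ j ∈ range (i + 1), invSubTwo p j ^ 2 *
      ∑ k ∈ range j, invSubTwo p k ^ 2
  -- Divisibility of this combination by `p²` lets `oddProd p n`, which is 1 modulo `p³`, be
  -- replaced by 1 modulo `p^5`.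
  have hcross : 4 * altSubTwo p n 1 + (invPowSum n 1 - p ^ 2 * T + p ^ 4 * T2) ∈ pIdeal p 2 := by
    have hpm : (p : ℚ) ^ 2 ∈ pIntegral p := pow_mem (natCast_mem _ _) 2
    have h1 : (p : ℚ) ^ 2 * (4 * altSubTwo p n 3 + 4 * (p ^ 2 * altSubTwo p n 5) + T -
        p ^ 2 * T2) ∈ pIdeal p 2 :=
      ⟨_, sub_mem (add_mem (add_mem (mul_mem (ofNat_mem _ 4) (altSubTwo_mem hpn 3))
        (mul_mem (ofNat_mem _ 4) (mul_mem hpm (altSubTwo_mem hpn 5)))) hmt) (mul_mem hpm hmt2),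
        rfl⟩
    convert sub_mem (add_mem (mul_mem_pIdeal (ofNat_mem _ 4)
      (pIdeal_mono (by norm_num : 2 ≤ 5) hA))
      (pow_mul_mem_pIdeal 1 (harmonicQuot_mem hpn h5))) h1 using 1
    ring
  have hδ' := mul_mem_pIdeal_add hδ hcross
  -- `hR`, `hU` and `hδ'` together remove `oddProd p n`; the other multipliers eliminate every sum
  -- except `H_{p-1}` and `p^4 B_{p-5}`.
  convert add_mem (add_mem (add_mem (add_mem (add_mem (add_mem (add_mem (add_mem (add_mem
    (add_mem (add_mem (add_mem (add_mem (add_mem (add_mem (add_mem (add_mem (add_mem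
    (mul_mem_pIdeal (ofNat_mem _ 160) hR) (mul_mem_pIdeal (neg_mem (ofNat_mem _ 160)) hU))
    (mul_mem_pIdeal (ofNat_mem _ 160) hδ')) (mul_mem_pIdeal (ofNat_mem _ 1280) hA))
    (mul_mem_pIdeal (neg_mem (ofNat_mem _ 80)) hA3)) (mul_mem_pIdeal (ofNat_mem _ 200) hA5))
    (mul_mem_pIdeal (neg_mem (ofNat_mem _ 40)) ht)) (mul_mem_pIdeal (ofNat_mem _ 40) hD))
    (mul_mem_pIdeal (ofNat_mem _ 10) ht2)) (mul_mem_pIdeal (neg_mem (ofNat_mem _ 10)) hD2))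
    (mul_mem_pIdeal (ofNat_mem _ 20) hSS)) (mul_mem_pIdeal (ofNat_mem _ 2) h3))
    (mul_mem_pIdeal (neg_mem (ofNat_mem _ 5)) h4)) (mul_mem_pIdeal (ofNat_mem _ 8) h22))
    (mul_mem_pIdeal (neg_mem (ofNat_mem _ 20)) hh5)) (mul_mem_pIdeal (ofNat_mem _ 5) h41))
    (mul_mem_pIdeal (ofNat_mem _ 40) h32)) (mul_mem_pIdeal (ofNat_mem _ 50) h23))
    (mul_mem_pIdeal (neg_mem (ofNat_mem _ 5)) hAt) using 1
  push_cast
  ring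

theorem sum_choose_div_sixteen_pow_mem (hpn : p = 2 * n + 1) (h5 : 5 < p) :
    ∑ k ∈ range n, ((2 * k).choose k : ℚ) / (16 ^ k * (2 * k + 1)) - (-1) ^ n *
      (p * harmonicQuot p / 12 + 3 / 160 * p ^ 4 * bernoulli (p - 5)) ∈ pIdeal p 5 := by
  refine mem_pIdeal_of_natCast_mul_mem (m := 3) (not_dvd_of_smooth h5 0 1 0) ?_
  have e := sum_choose_div_sixteen_pow n
  have e1 := sum_neg_one_pow_div_odd hpn
  have hs : (-1 : ℚ) ^ n * (-1) ^ n = 1 := by rw [← mul_pow]; simp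
  have hA : altSubTwo p n 1 = ∑ i ∈ range n, (-1) ^ (i + 1) * invSubTwo p i := by
    simp only [altSubTwo, pow_one]
  convert mul_mem_pIdeal (mul_mem (ofNat_mem _ 4) (neg_one_pow_mem n))
    (altSubTwo_add_sum_oddTerm_mem hpn h5) using 1
  rw [hA, ← e1]
  push_cast
  linear_combination 4 * e - 4 * (∑ k ∈ range n, (-1) ^ k / (2 * (k : ℚ) + 1)) * hs

end

theorem mainTheorem1 (p : ℕ) (hp : p.Prime) (hp5 : 5 < p) :
    RatModEqPrimePow p 5
      (∑ k ∈ Finset.range ((p - 3) / 2 + 1),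
        (Nat.choose (2 * k) k : ℚ) / ((16 : ℚ) ^ k * (2 * (k : ℚ) + 1)))
      ((-1 : ℚ) ^ ((p - 1) / 2) *
        (harmonic (p - 1) / 12 + (3 / 160 : ℚ) * (p : ℚ) ^ 4 * bernoulli (p - 5))) ∧
    RatModEqPrimePow p 4
      (∑ k ∈ Finset.range ((p - 3) / 2 + 1),
        (Nat.choose (2 * k) k : ℚ) / ((-16 : ℚ) ^ k * (2 * (k : ℚ) + 1) ^ 2))
      (harmonic (p - 1) / (5 * (p : ℚ)) +
        (7 / 200 : ℚ) * (p : ℚ) ^ 3 * bernoulli (p - 5)) := by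
  have : Fact p.Prime := ⟨hp⟩
  obtain ⟨n, hpn⟩ := hp.odd_of_ne_two (by omega)
  have h1 := sum_choose_div_sixteen_pow_mem hpn hp5
  have h2 := sum_choose_div_neg_sixteen_pow_mem hpn hp5
  rw [harmonicQuot, mul_div_cancel₀ _ cast_prime_ne_zero] at h1
  rw [harmonicQuot, div_div, mul_comm (p : ℚ) 5] at h2
  rw [show (p - 3) / 2 + 1 = n by omega, show (p - 1) / 2 = n by omega]
  exact ⟨ratModEqPrimePow_iff_mem_pIdeal.2 h1, ratModEqPrimePow_iff_mem_pIdeal.2 h2⟩
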